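/- Let $\Omega\subset\mathbb{C}^n$ be a bounded domain with smooth boundary and let $b$ be a real function on $\partial\Omega$. For a real function $v\in C^\infty(\overline\Omega)$ let $\mathrm{Hess}_{\mathbb C}v=\sqrt{-1}\,\partial\bar\partial v$ be its complex Hessian, let $\lambda_1,\dots,\lambda_n$ be the eigenvalues of the Hermitian matrix $(\partial^2 v/\partial z_j\partial\bar z_k)$, let $\Theta(\mathrm{Hess}_{\mathbb C}v)=\sum_{i=1}^n\mathrm{arccot}\,\lambda_i$ with $\mathrm{arccot}$ taking values in $(0,\pi)$, and let $\omega_0=\sqrt{-1}\sum_{i=1}^n dz_i\wedge d\bar z_i$. Put $$\mathcal H=\{v\in C^\infty(\overline\Omega)\;:\;\Theta(\mathrm{Hess}_{\mathbb C}v)\in(0,\tfrac{\pi}{2})\text{ in }\Omega,\ v|_{\partial\Omega}=b\}.$$ A smooth family in $\mathcal H$ parametrized by a compact interval $J$ is a function $v(z,s)$, smooth on $\overline\Omega\times J$, with $v(\cdot,s)\in\mathcal H$ for every $s\in J$. Fix $\phi\in\mathcal H$. For $\psi\in\mathcal H$ and a smooth family $v$ in $\mathcal H$ parametrized by $[0,1]$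 with $v(\cdot,0)=\phi$ and $v(\cdot,1)=\psi$ (a smooth path from $\phi$ to $\psi$), consider $$CY_\phi(\psi)=\int_0^1\!\!\int_\Omega \partial_s v\,\big[(\mathrm{Hess}_{\mathbb C}v+\sqrt{-1}\,\omega_0)^n-(\mathrm{Hess}_{\mathbb C}\phi+\sqrt{-1}\,\omega_0)^n\big]\,ds+\int_\Omega\psi\,(\mathrm{Hess}_{\mathbb C}\phi+\sqrt{-1}\,\omega_0)^n .$$ Then $CY_\phi(\psi)$ is well defined for every $\psi\in\mathcal H$: there is a smooth path in $\mathcal H$ from $\phi$ to $\psi$, for every such path the integrals converge absolutely, and the value does not depend on the path. Moreover $$\delta CY_\phi(\psi)=\int_\Omega(\delta\psi)\,(\mathrm{Hess}_{\mathbb C}\psi+\sqrt{-1}\,\omega_0)^n ,$$ that is, for every smooth family $(\psi_t)_{t\in[a,c]}$ in $\mathcal H$ with $a<c$, and every $t\in[a,c]$, the integral below converges absolutely, the function $t\mapsto CY_\phi(\psi_t)$ is differentiable at $t$ (one-sidedly at the endpoints), and $$\frac{d}{dt}CY_\phi(\psi_t)=\int_\Omega(\partial_t\psi_t)\,(\mathrm{Hess}_{\mathbb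 C}\psi_t+\sqrt{-1}\,\omega_0)^n .$$ -/

import Mathlib

open Set MeasureTheory
open scoped ContDiff Matrix

noncomputable section

/-! ### Domains with smooth boundary in complex Euclidean space

The space `Fin n → ℂ` carries the Lebesgue measure `dx₁dy₁⋯dxₙdyₙ`, and its topology and smooth
structure (as a real vector space) are those of `ℂⁿ`. -/

/-- `Ω ⊂ ℂⁿ` is a bounded domain with smooth boundary: near every boundary point `Ω` is the
negativity set of a smooth function without critical points. -/
structure IsSmoothBoundedDomain {n : ℕ} (Ω : Set (Fin n → ℂ)) : Prop where
  isOpen : IsOpen Ω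
  isConnected : IsConnected Ω
  isBounded : Bornology.IsBounded Ω
  smooth_boundary : ∀ p ∈ frontier Ω, ∃ (U : Set (Fin n → ℂ)) (ρ : (Fin n → ℂ) → ℝ),
    IsOpen U ∧ p ∈ U ∧ ContDiffOn ℝ ∞ ρ U ∧ (∀ z ∈ U, fderiv ℝ ρ z ≠ 0) ∧
      Ω ∩ U = {z ∈ U | ρ z < 0}

/-! ### The complex Hessian -/

/-- The Wirtinger derivative `∂f/∂zⱼ = (∂f/∂xⱼ - i ∂f/∂yⱼ) / 2`. -/
def wirtinger {n : ℕ} (j : Fin n) (f : (Fin n → ℂ) → ℂ) (z : Fin n → ℂ) : ℂ :=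
  (1 / 2 : ℂ) * (fderiv ℝ f z (Pi.single j 1) - Complex.I * fderiv ℝ f z (Pi.single j Complex.I))

/-- The Wirtinger derivative `∂f/∂z̄ⱼ = (∂f/∂xⱼ + i ∂f/∂yⱼ) / 2`. -/
def wirtingerBar {n : ℕ} (j : Fin n) (f : (Fin n → ℂ) → ℂ) (z : Fin n → ℂ) : ℂ :=
  (1 / 2 : ℂ) * (fderiv ℝ f z (Pi.single j 1) + Complex.I * fderiv ℝ f z (Pi.single j Complex.I))

/-- The matrix `(∂²u/∂zⱼ∂z̄ₖ)` of the complex Hessian of a real function `u` at `z`. -/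
def complexHessian {n : ℕ} (u : (Fin n → ℂ) → ℝ) (z : Fin n → ℂ) : Matrix (Fin n) (Fin n) ℂ :=
  Matrix.of fun j k => wirtinger j (fun w => wirtingerBar k (fun x => (u x : ℂ)) w) z

/-- The branch of the inverse cotangent with values in `(0, π)`. -/
def arccot (x : ℝ) : ℝ := Real.pi / 2 - Real.arctan x

open Classical in
/-- `Θ(A) = ∑ᵢ arccot λᵢ(A)`, summed over the eigenvalues of the Hermitian matrix `A` with
multiplicity (and `0` if `A` is not Hermitian; the complex Hessian of a real `C²` function is
always Hermitian, see `complexHessian_isHermitian`). -/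
def lagrangianPhase {n : ℕ} (A : Matrix (Fin n) (Fin n) ℂ) : ℝ :=
  if h : A.IsHermitian then ∑ i, arccot (h.eigenvalues i) else 0

/-! ### Exterior forms at a point

Complex-valued exterior forms at a point are elements of the exterior algebra of the complex
vector space of real-linear maps `ℂⁿ → ℂ`; multiplication is the wedge product. -/

/-- Complex-valued real covectors on `ℂⁿ`. -/
abbrev Covector (n : ℕ) : Type := (Fin n → ℂ) →ₗ[ℝ] ℂ

/-- The covector `dzⱼ`. -/
def dz {n : ℕ} (j : Fin n) : Covector n := LinearMap.proj j

/-- The covector `dz̄ⱼ`. -/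
def dzBar {n : ℕ} (j : Fin n) : Covector n :=
  Complex.conjAe.toLinearMap ∘ₗ (LinearMap.proj j : (Fin n → ℂ) →ₗ[ℝ] ℂ)

/-- The `(1,1)`-form `i ∑ⱼₖ Aⱼₖ dzⱼ ∧ dz̄ₖ`. -/
def formOfMatrix {n : ℕ} (A : Matrix (Fin n) (Fin n) ℂ) : ExteriorAlgebra ℂ (Covector n) :=
  Complex.I • ∑ j, ∑ k, A j k • (ExteriorAlgebra.ι ℂ (dz j) * ExteriorAlgebra.ι ℂ (dzBar k))

/-- The standard metric `ω₀ = i ∑ⱼ dzⱼ ∧ dz̄ⱼ`. -/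
def standardForm (n : ℕ) : ExteriorAlgebra ℂ (Covector n) :=
  Complex.I • ∑ j : Fin n, ExteriorAlgebra.ι ℂ (dz j) * ExteriorAlgebra.ι ℂ (dzBar j)

/-- The complex Hessian of `u` at `z` as a `(1,1)`-form,
`i∂∂̄u = i ∑ⱼₖ ∂²u/∂zⱼ∂z̄ₖ dzⱼ ∧ dz̄ₖ`. -/
def hessianForm {n : ℕ} (u : (Fin n → ℂ) → ℝ) (z : Fin n → ℂ) : ExteriorAlgebra ℂ (Covector n) :=
  formOfMatrix (complexHessian u z)

/-- The oriented real basis `e₁, i e₁, …, eₙ, i eₙ` of `ℂⁿ`. -/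
def realBasis (n : ℕ) (c : Fin (n * 2)) : Fin n → ℂ :=
  Pi.single (finProdFinEquiv.symm c).1 (![1, Complex.I] (finProdFinEquiv.symm c).2)

/-- Values of a covector on `realBasis n`. -/
def evalBasis (n : ℕ) : Covector n →ₗ[ℂ] (Fin (n * 2) → ℂ) where
  toFun α := fun c => α (realBasis n c)
  map_add' _ _ := rfl
  map_smul' _ _ := rfl

/-- The coefficient of a form with respect to the Euclidean volume form
`dx₁ ∧ dy₁ ∧ ⋯ ∧ dxₙ ∧ dyₙ`, i.e. the value of its part of degree `2n` on
`e₁, i e₁, …, eₙ, i eₙ`. On `α₁ ∧ ⋯ ∧ α₂ₙ` it is the determinant of the values of the `αᵢ`. -/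
def volumeCoeff (n : ℕ) : ExteriorAlgebra ℂ (Covector n) →ₗ[ℂ] ℂ :=
  ExteriorAlgebra.liftAlternating
    (Pi.single (n * 2) (Matrix.detRowAlternating.compLinearMap (evalBasis n)))

/-- The density with respect to Lebesgue measure of the `2n`-form `(i∂∂̄u + i ω₀)ⁿ`, so that
`∫_Ω f (i∂∂̄u + i ω₀)ⁿ` is the Lebesgue integral of `f * hessianDensity u` over `Ω`. -/
def hessianDensity {n : ℕ} (u : (Fin n → ℂ) → ℝ) (z : Fin n → ℂ) : ℂ :=
  volumeCoeff n ((hessianForm u z + Complex.I • standardForm n) ^ n)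

/-! ### Helper facts about these definitions -/

theorem volumeCoeff_prod {n : ℕ} (a b : Fin n → Covector n) :
    volumeCoeff n
        (List.ofFn fun i => ExteriorAlgebra.ι ℂ (a i) * ExteriorAlgebra.ι ℂ (b i)).prod =
      Matrix.det (Matrix.fromBlocks
        (Matrix.of fun i j : Fin n => a i (Pi.single j 1))
        (Matrix.of fun i j : Fin n => a i (Pi.single j Complex.I))
        (Matrix.of fun i j : Fin n => b i (Pi.single j 1))
        (Matrix.of fun i j : Fin n => b i (Pi.single j Complex.I))) := by
  set w : Fin (n * 2) → Covector n :=
    fun c => ![a (finProdFinEquiv.symm c).1, b (finProdFinEquiv.symm c).1]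
      (finProdFinEquiv.symm c).2 with hw
  have h1 : (List.ofFn fun i => ExteriorAlgebra.ι ℂ (a i) * ExteriorAlgebra.ι ℂ (b i)).prod
      = ExteriorAlgebra.ιMulti ℂ (n * 2) w := by
    rw [ExteriorAlgebra.ιMulti_apply, List.ofFn_mul, List.prod_flatten, List.map_ofFn]
    congr 2
    funext i
    have key : ∀ (j : Fin 2) (h : (i : ℕ) * 2 + (j : ℕ) < n * 2),
        w ⟨(i : ℕ) * 2 + j, h⟩ = ![a i, b i] j := by
      intro j h
      have : (⟨(i : ℕ) * 2 + j, h⟩ : Fin (n * 2)) = finProdFinEquiv (i, j) := by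
        ext; simp [finProdFinEquiv]; ring
      simp only [hw, this, Equiv.symm_apply_apply]
    simp only [Function.comp, key]
    simp [List.ofFn_succ]
  rw [h1, volumeCoeff, ExteriorAlgebra.liftAlternating_apply_ιMulti, Pi.single_eq_same]
  let e : Fin n ⊕ Fin n ≃ Fin (n * 2) :=
    (((Equiv.prodComm (Fin n) (Fin 2)).trans (finTwoEquiv.prodCongr (Equiv.refl _))).trans
      (Equiv.boolProdEquivSum (Fin n))).symm.trans finProdFinEquiv
  have hl : ∀ i, finProdFinEquiv.symm (e (Sum.inl i)) = (i, 0) := by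
    intro i; simp [e, finTwoEquiv]
  have hr : ∀ i, finProdFinEquiv.symm (e (Sum.inr i)) = (i, 1) := by
    intro i; simp [e, finTwoEquiv]
  rw [AlternatingMap.compLinearMap_apply]
  change Matrix.det (Matrix.of fun r c => w r (realBasis n c)) = _
  rw [← Matrix.det_submatrix_equiv_self e]
  congr 1
  ext (i | i) (j | j) <;>
    simp only [hw, realBasis, hl, hr, Matrix.submatrix_apply, Matrix.of_apply,
      Matrix.fromBlocks_apply₁₁, Matrix.fromBlocks_apply₁₂, Matrix.fromBlocks_apply₂₁,
      Matrix.fromBlocks_apply₂₂] <;> rfl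

theorem sum_det_sq_eq_factorial (n : ℕ) :
    ∑ f : Fin n → Fin n, (Matrix.det ((1 : Matrix (Fin n) (Fin n) ℂ).submatrix f id)) ^ 2 =
      (n.factorial : ℂ) := by
  rw [← Fintype.sum_of_injective (fun σ : Equiv.Perm (Fin n) => (σ : Fin n → Fin n))
    DFunLike.coe_injective (fun _ => (1 : ℂ))]
  · simp [Fintype.card_perm]
  · intro f hf
    have hni : ¬ Function.Injective f := fun hi =>
      hf ⟨Equiv.ofBijective f (Finite.injective_iff_bijective.1 hi), rfl⟩
    simp only [Function.Injective, not_forall] at hni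
    obtain ⟨i, j, hij, hne⟩ := hni
    rw [Matrix.det_zero_of_row_eq hne (by ext c; rw [Matrix.submatrix_apply, Matrix.submatrix_apply, hij])]
    simp
  · intro σ
    rw [Matrix.det_permute, Matrix.det_one, mul_one]
    rcases Int.units_eq_one_or (Equiv.Perm.sign σ) with h | h <;> simp [h]

/-- `(i ∑ⱼₖ Aⱼₖ dzⱼ ∧ dz̄ₖ)ⁿ = 2ⁿ n! det(A) dx₁ ∧ dy₁ ∧ ⋯ ∧ dxₙ ∧ dyₙ`. -/
theorem volumeCoeff_formOfMatrix_pow {n : ℕ} (A : Matrix (Fin n) (Fin n) ℂ) :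
    volumeCoeff n (formOfMatrix A ^ n) = 2 ^ n * n.factorial * A.det := by
  have h0 : formOfMatrix A = Complex.I • ∑ j, (ExteriorAlgebra.ι ℂ (dz j) *
      ExteriorAlgebra.ι ℂ (∑ k, A j k • dzBar k)) := by
    simp [formOfMatrix, Finset.mul_sum]
  have h1 : (∑ j, (ExteriorAlgebra.ι ℂ (dz j) *
      ExteriorAlgebra.ι ℂ (∑ k, A j k • dzBar k))) ^ n
      = ∑ f : Fin n → Fin n, (List.ofFn fun i => ExteriorAlgebra.ι ℂ (dz (f i)) *
      ExteriorAlgebra.ι ℂ (∑ k, A (f i) k • dzBar k)).prod := by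
    rw [← MultilinearMap.mkPiAlgebraFin_apply_const (R := ℂ), MultilinearMap.map_sum]
    simp
  have h2 : ∀ f : Fin n → Fin n,
      volumeCoeff n (List.ofFn fun i => ExteriorAlgebra.ι ℂ (dz (f i)) *
        ExteriorAlgebra.ι ℂ (∑ k, A (f i) k • dzBar k)).prod =
      (Matrix.det ((1 : Matrix (Fin n) (Fin n) ℂ).submatrix f id)) ^ 2 *
        ((-2 * Complex.I) ^ n * A.det) := by
    intro f
    rw [volumeCoeff_prod]
    set P := (1 : Matrix (Fin n) (Fin n) ℂ).submatrix f id with hP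
    have hb : ∀ i j, P i j = if f i = j then 1 else 0 := by
      intro i j; simp [hP, Matrix.one_apply]
    have hPA : ∀ i j, (P * A) i j = A (f i) j := by
      intro i j; simp [Matrix.mul_apply, hb]
    have : Matrix.fromBlocks
        (Matrix.of fun i j : Fin n => dz (f i) (Pi.single j 1))
        (Matrix.of fun i j : Fin n => dz (f i) (Pi.single j Complex.I))
        (Matrix.of fun i j : Fin n => (∑ k, A (f i) k • dzBar k) (Pi.single j 1))
        (Matrix.of fun i j : Fin n => (∑ k, A (f i) k • dzBar k) (Pi.single j Complex.I))
        = Matrix.fromBlocks P 0 0 P *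
          Matrix.fromBlocks 1 (Complex.I • 1) A (-Complex.I • A) := by
      rw [Matrix.fromBlocks_multiply]
      congr 1
      · ext i j
        simp [dz, hb, Pi.single_apply]
      · ext i j
        simp [dz, hb, Pi.single_apply]
      · ext i j
        simp [dzBar, hPA, Pi.single_apply, apply_ite (starRingEnd ℂ)]
      · ext i j
        simp [dzBar, hPA, Pi.single_apply, apply_ite (starRingEnd ℂ), mul_comm]
    rw [this, Matrix.det_mul, Matrix.det_fromBlocks_zero₂₁, Matrix.det_fromBlocks_one₁₁]
    have h3 : -Complex.I • A - A * (Complex.I • (1 : Matrix (Fin n) (Fin n) ℂ))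
        = (-2 * Complex.I) • A := by
      ext i j; simp; ring
    rw [h3, Matrix.det_smul, Fintype.card_fin]
    ring
  rw [h0, smul_pow, h1, map_smul, map_sum]
  simp only [h2]
  rw [← Finset.sum_mul, sum_det_sq_eq_factorial, smul_eq_mul]
  have h4 : Complex.I ^ n * (-2 * Complex.I) ^ n = 2 ^ n := by
    rw [← mul_pow]; congr 1; linear_combination -2 * Complex.I_sq
  linear_combination (n.factorial * A.det) * h4

theorem hessianDensity_eq {n : ℕ} (u : (Fin n → ℂ) → ℝ) (z : Fin n → ℂ) :
    hessianDensity u z =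
      2 ^ n * n.factorial * (complexHessian u z + Complex.I • 1).det := by
  have : hessianForm u z + Complex.I • standardForm n
      = formOfMatrix (complexHessian u z + Complex.I • 1) := by
    simp [hessianForm, standardForm, formOfMatrix, add_smul, Finset.sum_add_distrib,
      Matrix.one_apply, Finset.smul_sum, ite_smul, smul_smul]
  rw [hessianDensity, this, volumeCoeff_formOfMatrix_pow]

theorem complexHessian_isHermitian {n : ℕ} {u : (Fin n → ℂ) → ℝ} {z : Fin n → ℂ}
    (hu : ContDiffAt ℝ 2 u z) : (complexHessian u z).IsHermitian := by
  have hsymm : IsSymmSndFDerivAt ℝ u z := hu.isSymmSndFDerivAt (by simp)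
  have hD : HasFDerivAt (fderiv ℝ u) (fderiv ℝ (fderiv ℝ u) z) z :=
    ((hu.fderiv_right (m := 1) (by norm_num)).differentiableAt (by norm_num)).hasFDerivAt
  have hev : ∀ᶠ w in nhds z, DifferentiableAt ℝ u w :=
    (hu.eventually (by simp)).mono fun w hw => hw.differentiableAt (by norm_num)
  have hbar : ∀ k : Fin n, (fun w => wirtingerBar k (fun x => (u x : ℂ)) w) =ᶠ[nhds z]
      fun w => (1 / 2 : ℂ) * ((fderiv ℝ u w (Pi.single k 1) : ℂ) +
        Complex.I * (fderiv ℝ u w (Pi.single k Complex.I) : ℂ)) := by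
    intro k
    filter_upwards [hev] with w hw
    have : fderiv ℝ (fun x => (u x : ℂ)) w = Complex.ofRealCLM ∘L fderiv ℝ u w :=
      (Complex.ofRealCLM.hasFDerivAt.comp w hw.hasFDerivAt).fderiv
    simp [wirtingerBar, this]
  have hre : ∀ X : Fin n → ℂ, HasFDerivAt (fun w => (fderiv ℝ u w X : ℂ))
      (Complex.ofRealCLM ∘L ((ContinuousLinearMap.apply ℝ ℝ X) ∘L fderiv ℝ (fderiv ℝ u) z)) z :=
    fun X => Complex.ofRealCLM.hasFDerivAt.comp z
      ((ContinuousLinearMap.apply ℝ ℝ X).hasFDerivAt.comp z hD)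
  have hfd : ∀ (k : Fin n) (Y : Fin n → ℂ),
      fderiv ℝ (fun w => wirtingerBar k (fun x => (u x : ℂ)) w) z Y =
      (1 / 2 : ℂ) * ((fderiv ℝ (fderiv ℝ u) z Y (Pi.single k 1) : ℂ) +
        Complex.I * (fderiv ℝ (fderiv ℝ u) z Y (Pi.single k Complex.I) : ℂ)) := by
    intro k Y
    have h := ((hre (Pi.single k 1)).fun_add
      ((hre (Pi.single k Complex.I)).const_mul Complex.I)).const_mul (1 / 2 : ℂ)
    rw [(hbar k).fderiv_eq, h.fderiv]
    simp
    ring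
  ext j k
  simp only [complexHessian, Matrix.conjTranspose_apply, Matrix.of_apply, wirtinger, hfd]
  rw [hsymm.eq (Pi.single j 1) (Pi.single k 1), hsymm.eq (Pi.single j 1) (Pi.single k Complex.I),
    hsymm.eq (Pi.single j Complex.I) (Pi.single k 1),
    hsymm.eq (Pi.single j Complex.I) (Pi.single k Complex.I)]
  simp
  ring

/-! ### The space of potentials, paths, and the Calabi–Yau functional -/

/-- The potential space: functions `v`, smooth up to the boundary of `Ω`, with
`Θ(i∂∂̄v) ∈ (0, π/2)` in `Ω` and boundary values `b`. Values of `v` off `closure Ω` and of `b` off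
`frontier Ω` play no role. -/
def potentialSpace {n : ℕ} (Ω : Set (Fin n → ℂ)) (b : (Fin n → ℂ) → ℝ) :
    Set ((Fin n → ℂ) → ℝ) :=
  {v | ContDiffOn ℝ ∞ v (closure Ω) ∧
    (∀ z ∈ Ω, lagrangianPhase (complexHessian v z) ∈ Ioo 0 (Real.pi / 2)) ∧
    ∀ z ∈ frontier Ω, v z = b z}

/-- A smooth family `(v s)`, `s ∈ J`, in the potential space: smooth in `(s, z)` on
`J × closure Ω`. -/
def IsSmoothFamily {n : ℕ} (Ω : Set (Fin n → ℂ)) (b : (Fin n → ℂ) → ℝ) (J : Set ℝ)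
    (v : ℝ → (Fin n → ℂ) → ℝ) : Prop :=
  ContDiffOn ℝ ∞ (Function.uncurry v) (J ×ˢ closure Ω) ∧ ∀ s ∈ J, v s ∈ potentialSpace Ω b

/-- A smooth path `(v s)`, `s ∈ [0, 1]`, in the potential space which connects `φ` and `ψ`. -/
def IsSmoothPath {n : ℕ} (Ω : Set (Fin n → ℂ)) (b : (Fin n → ℂ) → ℝ)
    (φ ψ : (Fin n → ℂ) → ℝ) (v : ℝ → (Fin n → ℂ) → ℝ) : Prop :=
  IsSmoothFamily Ω b (Icc 0 1) v ∧ EqOn (v 0) φ (closure Ω) ∧ EqOn (v 1) ψ (closure Ω)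

/-- The value at `ψ` of the Calabi–Yau functional with base point `φ`, computed along `v`. -/
def calabiYauAlong {n : ℕ} (Ω : Set (Fin n → ℂ)) (φ ψ : (Fin n → ℂ) → ℝ)
    (v : ℝ → (Fin n → ℂ) → ℝ) : ℂ :=
  (∫ s in (0 : ℝ)..1, ∫ z in Ω,
      ((derivWithin (fun r => v r z) (Icc 0 1) s : ℝ) : ℂ) *
        (hessianDensity (v s) z - hessianDensity φ z)) +
    ∫ z in Ω, (ψ z : ℂ) * hessianDensity φ z

open Classical in
/-- The Calabi–Yau functional `CY_φ(ψ)`, computed along some smooth path in the potential space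
from `φ` to `ψ` (and `0` if there is none). -/
def calabiYau {n : ℕ} (Ω : Set (Fin n → ℂ)) (b : (Fin n → ℂ) → ℝ)
    (φ ψ : (Fin n → ℂ) → ℝ) : ℂ :=
  if h : ∃ v, IsSmoothPath Ω b φ ψ v then calabiYauAlong Ω φ ψ h.choose else 0

end

/-!
The Calabi–Yau functional is a primitive of the one-form `α_v(h) = ∫_Ω h (i∂∂̄v + iω₀)ⁿ` on the
space of potentials, so everything rests on `α` being closed.

Since `(i∂∂̄v + iω₀)ⁿ` has the density `2ⁿ n! det (Hess v + i)`, the derivative of `α_v(h)` in the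
direction `f` is a multiple of `∫_Ω h tr (adj (Hess v + i) Hess f)`, and closedness is the symmetry
of this expression in `f` and `h`, which vanish on the boundary because all potentials have the same
boundary values (`setIntegral_mul_trace_adjugate_comm`). It follows by two integrations by parts,
as the adjugate is divergence free (`sum_cderiv_adjugate_eq_zero`). For the last fact the matrix has
to be invertible, and it is: the Hessian is Hermitian, so its eigenvalues are not `-i`. The boundary
terms are absent since a function which vanishes on the boundary and has bounded derivatives in `Ω`
is Lipschitz when continued by zero (`setIntegral_fderiv_eq_zero_of_eq_zero`).

The primitive used here is the integral of `α` along the segment from `φ` to `ψ` (`segmentEnergy`).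
Closedness on triangles (`segmentEnergy_add_sub`) writes its increments as integrals of `α` along
segments, and dominated convergence then gives its derivative along every smooth family
(`IsSmoothFamily.hasDerivWithinAt_segmentEnergy`). Integrated over `[0, 1]`, this shows that the
functional computed along any smooth path is the energy of the segment, up to a constant
(`IsSmoothPath.calabiYauAlong_eq`), which is independence of the path.

Smooth paths exist because the space of potentials is convex: phase less than `π / 2` makes all
eigenvalues of the Hessian positive, and there the phase is the trace function of the convex
function `arccot`, hence convex in the matrix (`Matrix.IsHermitian.sum_eigenvalues_convex`).

The smooth boundary enters through `IsSmoothBoundedDomain.uniqueDiffOn_closure`: derivatives of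
functions which are smooth on the closure of `Ω` are again of this kind, in particular bounded.
-/

/-! ### Derivatives up to the boundary -/

open Filter Topology in
/-- At a boundary point `p` the tangent cone contains the open half-space of the vectors along
which the defining function decreases, and an open set spans. -/
theorem IsSmoothBoundedDomain.uniqueDiffOn_closure {n : ℕ} {Ω : Set (Fin n → ℂ)}
    (hΩ : IsSmoothBoundedDomain Ω) : UniqueDiffOn ℝ (closure Ω) := by
  intro p hp
  rw [uniqueDiffWithinAt_closure]
  by_cases hpΩ : p ∈ Ω
  · exact hΩ.isOpen.uniqueDiffWithinAt hpΩ
  have hfr : p ∈ frontier Ω := by rw [hΩ.isOpen.frontier_eq]; exact ⟨hp, hpΩ⟩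
  obtain ⟨U, ρ, hU, hpU, hρ, hρ0, hΩU⟩ := hΩ.smooth_boundary p hfr
  have hd : DifferentiableAt ℝ ρ p :=
    (hρ.contDiffAt (hU.mem_nhds hpU)).differentiableAt (by simp)
  have hρp : ρ p ≤ 0 := by
    have hcl : p ∈ closure (Ω ∩ U) := by
      rw [mem_closure_iff_nhdsWithin_neBot, inter_comm, nhdsWithin_inter_of_mem
        (mem_nhdsWithin_of_mem_nhds (hU.mem_nhds hpU))]
      exact mem_closure_iff_nhdsWithin_neBot.1 hp
    have := mem_closure_iff_nhdsWithin_neBot.1 hcl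
    refine le_of_tendsto (hd.continuousAt.continuousWithinAt (s := Ω ∩ U)) ?_
    filter_upwards [self_mem_nhdsWithin] with z hz
    rw [hΩU] at hz
    exact hz.2.le
  have hcone : {v | fderiv ℝ ρ p v < 0} ⊆ tangentConeAt ℝ Ω p := by
    intro v hv
    have hg : HasDerivAt (fun t : ℝ => ρ (p + t • v)) (fderiv ℝ ρ p v) 0 := by
      have h1 : HasDerivAt (fun t : ℝ => p + t • v) v 0 := by
        simpa using ((hasDerivAt_id (0 : ℝ)).smul_const v).const_add p
      have h2 : HasFDerivAt ρ (fderiv ℝ ρ p) (p + (0 : ℝ) • v) := by simpa using hd.hasFDerivAt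
      exact h2.comp_hasDerivAt 0 h1
    have hslope := hasDerivWithinAt_iff_tendsto_slope.1 (hg.hasDerivWithinAt (s := Ioi 0))
    have hev : ∀ᶠ t in 𝓝[>] (0 : ℝ), slope (fun t : ℝ => ρ (p + t • v)) 0 t < 0 := by
      have : Ioi (0 : ℝ) \ {0} = Ioi 0 := by simp
      rw [this] at hslope
      exact hslope.eventually_lt_const hv
    have hcont : Tendsto (fun t : ℝ => p + t • v) (𝓝[>] 0) (𝓝 p) := by
      have : Continuous fun t : ℝ => p + t • v := by fun_prop
      have h := this.tendsto 0
      simp only [zero_smul, add_zero] at h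
      exact h.mono_left nhdsWithin_le_nhds
    refine mem_tangentConeAt_of_add_smul_mem (l := 𝓝[>] (0 : ℝ)) (c := id)
      (tendsto_id'.2 (nhdsGT_le_nhdsNE 0)) ?_
    filter_upwards [hev, self_mem_nhdsWithin, hcont (hU.mem_nhds hpU)] with t ht ht0 htU
    have : p + t • v ∈ {z ∈ U | ρ z < 0} := by
      refine ⟨htU, ?_⟩
      have ht0' : (0 : ℝ) < t := ht0
      rw [slope_def_field, div_lt_iff₀ (by simpa using ht0')] at ht
      simp only [zero_smul, add_zero, zero_mul] at ht
      linarith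
    rw [← hΩU] at this
    exact this.1
  rw [uniqueDiffWithinAt_iff]
  refine ⟨?_, hp⟩
  have htop : Submodule.span ℝ (tangentConeAt ℝ Ω p) = ⊤ := by
    apply Submodule.eq_top_of_nonempty_interior'
    obtain ⟨w, hw⟩ : ∃ w, fderiv ℝ ρ p w ≠ 0 := by
      by_contra! h
      exact hρ0 p hpU (by ext w; simpa using h w)
    have hopen : IsOpen {v | fderiv ℝ ρ p v < 0} :=
      isOpen_lt (fderiv ℝ ρ p).continuous continuous_const
    have hsub : {v | fderiv ℝ ρ p v < 0} ⊆
        interior (Submodule.span ℝ (tangentConeAt ℝ Ω p) : Set (Fin n → ℂ)) :=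
      interior_maximal (hcone.trans Submodule.subset_span) hopen
    rcases lt_or_gt_of_ne hw with h | h
    · exact ⟨w, hsub h⟩
    · exact ⟨-w, hsub (by simpa using h)⟩
  rw [htop]
  simp

/-! ### The divergence theorem for functions vanishing on the boundary -/

section Divergence

variable {E : Type*} [NormedAddCommGroup E] [NormedSpace ℝ E] [FiniteDimensional ℝ E]

open Filter Topology in
/-- Off a countable set of points, which are isolated in the zero set of `g` on one side, the
derivative of `g` at its zeros is zero. -/
theorem ae_deriv_eq_zero_of_eq_zero (g : ℝ → ℝ) : ∀ᵐ t, g t = 0 → deriv g t = 0 := by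
  have hc := (countable_setOfPred_isolated_right_within (s := {t : ℝ | g t = 0})).ae_notMem volume
  filter_upwards [hc] with t ht h0
  by_cases hd : DifferentiableAt ℝ g t
  swap
  · exact deriv_zero_of_not_differentiableAt hd
  have hne : (𝓝[{t : ℝ | g t = 0} ∩ Ioi t] t).NeBot := ⟨fun h => ht ⟨h0, h⟩⟩
  have hs : ({t : ℝ | g t = 0} ∩ Ioi t) \ {t} = {t : ℝ | g t = 0} ∩ Ioi t := by
    apply sdiff_singleton_eq_self
    simp
  have h1 := hasDerivWithinAt_iff_tendsto_slope.1
    (hd.hasDerivAt.hasDerivWithinAt (s := {t : ℝ | g t = 0} ∩ Ioi t))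
  rw [hs] at h1
  have h2 : Tendsto (slope g t) (𝓝[{t : ℝ | g t = 0} ∩ Ioi t] t) (𝓝 0) := by
    refine tendsto_const_nhds.congr' ?_
    filter_upwards [self_mem_nhdsWithin] with x hx
    have : g x = 0 := hx.1
    simp [slope_def_field, this, h0]
  exact tendsto_nhds_unique h1 h2

/-- A function with bounded derivative in `Ω`, continued by zero, is bounded by the distance to the
complement of `Ω`, as one sees on the ball around `x` which touches the boundary. -/
theorem abs_le_mul_infDist_compl {Ω : Set E} (hΩ : IsOpen Ω) (hne : Ω ≠ univ) {W : E → ℝ}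
    (hW : Continuous W) (h0 : ∀ x ∉ Ω, W x = 0) (hd : ∀ x ∈ Ω, DifferentiableAt ℝ W x)
    {C : ℝ} (hC : ∀ x ∈ Ω, ‖fderiv ℝ W x‖ ≤ C) {x : E} (hx : x ∈ Ω) :
    |W x| ≤ C * Metric.infDist x Ωᶜ := by
  obtain ⟨y, hy, hxy⟩ := exists_mem_frontier_infDist_compl_eq_dist hx hne
  have hyΩ : y ∉ Ω := by rw [hΩ.frontier_eq] at hy; exact hy.2
  have hr : 0 < Metric.infDist x Ωᶜ := by
    rw [hxy]; exact dist_pos.2 fun h => hyΩ (h ▸ hx)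
  have hball : Metric.ball x (Metric.infDist x Ωᶜ) ⊆ Ω := Metric.ball_infDist_compl_subset
  have hb : ∀ z ∈ Metric.ball x (Metric.infDist x Ωᶜ), |W x| - C * ‖x - z‖ ≤ |W z| := by
    intro z hz
    have := (convex_ball x (Metric.infDist x Ωᶜ)).norm_image_sub_le_of_norm_fderiv_le
      (fun w hw => hd w (hball hw)) (fun w hw => hC w (hball hw)) hz (Metric.mem_ball_self hr)
    rw [Real.norm_eq_abs] at this
    have h2 := abs_sub_abs_le_abs_sub (W x) (W z)
    linarith
  have hycl : y ∈ closure (Metric.ball x (Metric.infDist x Ωᶜ)) := by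
    rw [closure_ball x hr.ne', Metric.mem_closedBall, dist_comm, hxy]
  have hle : |W x| - C * ‖x - y‖ ≤ |W y| := by
    have hcl : IsClosed {z | |W x| - C * ‖x - z‖ ≤ |W z|} :=
      isClosed_le (by fun_prop) (by fun_prop)
    exact closure_minimal hb hcl hycl
  rw [h0 y hyΩ, abs_zero, ← dist_eq_norm, ← hxy] at hle
  linarith

theorem lipschitzWith_of_fderiv_le_of_eq_zero {Ω : Set E} (hΩ : IsOpen Ω) (hne : Ω ≠ univ)
    {W : E → ℝ} (hW : Continuous W) (h0 : ∀ x ∉ Ω, W x = 0)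
    (hd : ∀ x ∈ Ω, DifferentiableAt ℝ W x) {C : NNReal} (hC : ∀ x ∈ Ω, ‖fderiv ℝ W x‖ ≤ C) :
    LipschitzWith C W := by
  have key : ∀ x, ∀ p ∉ Ω, |W x| ≤ C * ‖x - p‖ := by
    intro x p hp
    by_cases hx : x ∈ Ω
    · refine (abs_le_mul_infDist_compl hΩ hne hW h0 hd hC hx).trans ?_
      rw [← dist_eq_norm]
      exact mul_le_mul_of_nonneg_left (Metric.infDist_le_dist_of_mem hp) C.2
    · rw [h0 x hx, abs_zero]; positivity
  refine LipschitzWith.of_dist_le_mul fun x y => ?_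
  rw [dist_eq_norm, dist_eq_norm]
  by_cases hseg : segment ℝ x y ⊆ Ω
  · exact (convex_segment x y).norm_image_sub_le_of_norm_fderiv_le (fun w hw => hd w (hseg hw))
      (fun w hw => hC w (hseg hw)) (right_mem_segment ℝ x y) (left_mem_segment ℝ x y)
  · obtain ⟨p, hp, hpΩ⟩ := not_subset.1 hseg
    have h1 := key x p hpΩ
    have h2 := key y p hpΩ
    have h3 : ‖x - p‖ + ‖y - p‖ = ‖x - y‖ := by
      have := dist_add_dist_of_mem_segment hp
      rw [dist_eq_norm, dist_eq_norm, dist_eq_norm] at this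
      rw [← this, norm_sub_rev y p]
    calc ‖W x - W y‖ ≤ ‖W x‖ + ‖W y‖ := norm_sub_le _ _
      _ ≤ C * ‖x - p‖ + C * ‖y - p‖ := add_le_add h1 h2
      _ = C * ‖x - y‖ := by rw [← mul_add, h3]

variable [MeasurableSpace E] [BorelSpace E] {μ : Measure E} [μ.IsAddHaarMeasure]

/-- The continuation by zero is Lipschitz. The integral of its derivative is zero, and the zeros of
the function contribute nothing to it, whatever the boundary of `Ω` looks like. -/
theorem setIntegral_fderiv_eq_zero_of_eq_zero {Ω : Set E} (hΩ : IsOpen Ω) (hne : Ω ≠ univ)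
    (hb : Bornology.IsBounded Ω) {W : E → ℝ} (hW : Continuous W) (h0 : ∀ x ∉ Ω, W x = 0)
    (hd : ∀ x ∈ Ω, DifferentiableAt ℝ W x) {C : ℝ} (hC : ∀ x ∈ Ω, ‖fderiv ℝ W x‖ ≤ C) (v : E) :
    ∫ x in Ω, fderiv ℝ W x v ∂μ = 0 := by
  have hLip : LipschitzWith C.toNNReal W :=
    lipschitzWith_of_fderiv_le_of_eq_zero hΩ hne hW h0 hd
      fun x hx => (hC x hx).trans (Real.le_coe_toNNReal C)
  have hcs : HasCompactSupport W :=
    HasCompactSupport.intro hb.isCompact_closure fun x hx => h0 x fun h => hx (subset_closure h)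
  have h1 : ∫ x, lineDeriv ℝ W x v ∂μ = 0 := by
    have := LipschitzWith.integral_lineDeriv_mul_eq (μ := μ) (LipschitzWith.const (1 : ℝ)) hLip hcs
      (-v)
    simpa [lineDeriv] using this.symm
  have h2 : ∀ᵐ x ∂μ, W x = 0 → lineDeriv ℝ W x v = 0 := by
    let L : ℝ →L[ℝ] E := ContinuousLinearMap.smulRight (1 : ℝ →L[ℝ] ℝ) v
    have hms : MeasurableSet {x | W x = 0 → lineDeriv ℝ W x v = 0} := by
      have e : {x | W x = 0 → lineDeriv ℝ W x v = 0} =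
          {x | W x = 0}ᶜ ∪ {x | lineDeriv ℝ W x v = 0} := by
        ext x; simp [imp_iff_not_or]
      rw [e]
      exact ((measurableSet_eq_fun hW.measurable measurable_const).compl).union
        (measurableSet_eq_fun (measurable_lineDeriv hW) measurable_const)
    refine ae_mem_of_ae_add_linearMap_mem L.toLinearMap volume μ hms fun y => ?_
    filter_upwards [ae_deriv_eq_zero_of_eq_zero fun t : ℝ => W (y + t • v)] with t ht
    change W (y + L t) = 0 → lineDeriv ℝ W (y + L t) v = 0
    intro h
    have h' : W (y + t • v) = 0 := by simpa [L] using h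
    have hder : lineDeriv ℝ W (y + t • v) v = deriv (fun t : ℝ => W (y + t • v)) t := by
      rw [lineDeriv]
      have := deriv_comp_const_add (f := fun t : ℝ => W (y + t • v)) t 0
      simp only [add_zero] at this
      rw [← this]
      congr 1
      funext s
      rw [add_smul, add_assoc]
    simpa [L, hder] using ht h'
  have h3 : ∫ x in Ω, lineDeriv ℝ W x v ∂μ = ∫ x, lineDeriv ℝ W x v ∂μ := by
    apply setIntegral_eq_integral_of_ae_compl_eq_zero
    filter_upwards [h2] with x hx hxΩ
    exact hx (h0 x hxΩ)
  rw [← h1, ← h3]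
  refine setIntegral_congr_fun hΩ.measurableSet fun x hx => ?_
  exact ((hd x hx).lineDeriv_eq_fderiv).symm

end Divergence

/-! ### Convexity of the phase condition -/

section Eigenvalues

variable {ι : Type*} [Fintype ι] [DecidableEq ι]

/-- The quadratic form of a Hermitian matrix in an orthonormal eigenbasis. -/
theorem Matrix.IsHermitian.re_inner_mulVec_eq_sum {A : Matrix ι ι ℂ} (hA : A.IsHermitian)
    (x : EuclideanSpace ℂ ι) :
    (inner ℂ x (WithLp.toLp 2 (A *ᵥ x.ofLp))).re =
      ∑ j, ‖inner ℂ (hA.eigenvectorBasis j) x‖ ^ 2 * hA.eigenvalues j := by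
  have hsym := Matrix.isSymmetric_toEuclideanLin_iff.2 hA
  have h1 : ∀ j, inner ℂ (hA.eigenvectorBasis j) (WithLp.toLp 2 (A *ᵥ x.ofLp)) =
      (hA.eigenvalues j : ℂ) * inner ℂ (hA.eigenvectorBasis j) x := by
    intro j
    have e1 : (WithLp.toLp 2 (A *ᵥ x.ofLp) : EuclideanSpace ℂ ι) = Matrix.toEuclideanLin A x := rfl
    have e2 : Matrix.toEuclideanLin A (hA.eigenvectorBasis j) =
        (hA.eigenvalues j : ℂ) • hA.eigenvectorBasis j := by
      apply (WithLp.ofLp_injective 2)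
      have := hA.mulVec_eigenvectorBasis j
      simpa using this
    rw [e1, ← hsym, e2, inner_smul_left]
    simp
  rw [← hA.eigenvectorBasis.sum_inner_mul_inner x, Complex.re_sum]
  refine Finset.sum_congr rfl fun j _ => ?_
  rw [h1, mul_left_comm, ← inner_conj_symm x, Complex.conj_mul', ← Complex.ofReal_pow,
    ← Complex.ofReal_mul, Complex.ofReal_re, mul_comm]

/-- Convexity of the trace function of a convex function: by Jensen's inequality the diagonal
entries of `A` and `B` in an eigenbasis of `a A + b B` have a smaller trace function than the
eigenvalues. -/
theorem Matrix.IsHermitian.sum_eigenvalues_convex {f : ℝ → ℝ} {S : Set ℝ} (hf : ConvexOn ℝ S f)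
    {A B : Matrix ι ι ℂ} (hA : A.IsHermitian) (hB : B.IsHermitian)
    (hAS : ∀ i, hA.eigenvalues i ∈ S) (hBS : ∀ i, hB.eigenvalues i ∈ S)
    {a b : ℝ} (ha : 0 ≤ a) (hb : 0 ≤ b) (hab : a + b = 1)
    (hC : ((a : ℂ) • A + (b : ℂ) • B).IsHermitian) :
    (∀ i, hC.eigenvalues i ∈ S) ∧ ∑ i, f (hC.eigenvalues i) ≤
      a * ∑ i, f (hA.eigenvalues i) + b * ∑ i, f (hB.eigenvalues i) := by
  set p : ∀ A : Matrix ι ι ℂ, A.IsHermitian → ι → ι → ℝ := fun A hA i j =>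
    ‖inner ℂ (hA.eigenvectorBasis j) (hC.eigenvectorBasis i)‖ ^ 2 with hp
  have hp0 : ∀ {A : Matrix ι ι ℂ} (hA : A.IsHermitian) i j, 0 ≤ p _ hA i j := by
    intro A hA i j; simp only [hp]; positivity
  have hp1 : ∀ {A : Matrix ι ι ℂ} (hA : A.IsHermitian) i, ∑ j, p _ hA i j = 1 := by
    intro A hA i
    simp only [hp]
    rw [hA.eigenvectorBasis.sum_sq_norm_inner_right]
    simp
  have hp2 : ∀ {A : Matrix ι ι ℂ} (hA : A.IsHermitian) j, ∑ i, p _ hA i j = 1 := by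
    intro A hA j
    simp only [hp]
    rw [hC.eigenvectorBasis.sum_sq_norm_inner_left]
    simp
  have hmem : ∀ {A : Matrix ι ι ℂ} (hA : A.IsHermitian), (∀ i, hA.eigenvalues i ∈ S) → ∀ i,
      ∑ j, p _ hA i j * hA.eigenvalues j ∈ S := fun hA hAS i =>
    hf.1.sum_mem (fun j _ => hp0 hA i j) (hp1 hA i) fun j _ => hAS j
  have hjen : ∀ {A : Matrix ι ι ℂ} (hA : A.IsHermitian), (∀ i, hA.eigenvalues i ∈ S) → ∀ i,
      f (∑ j, p _ hA i j * hA.eigenvalues j) ≤ ∑ j, p _ hA i j * f (hA.eigenvalues j) :=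
    fun hA hAS i => hf.map_sum_le (fun j _ => hp0 hA i j) (hp1 hA i) fun j _ => hAS j
  have htot : ∀ {A : Matrix ι ι ℂ} (hA : A.IsHermitian),
      ∑ i, ∑ j, p _ hA i j * f (hA.eigenvalues j) = ∑ j, f (hA.eigenvalues j) := by
    intro A hA
    rw [Finset.sum_comm]
    simp_rw [← Finset.sum_mul, hp2, one_mul]
  have heig : ∀ i, hC.eigenvalues i =
      a * (∑ j, p _ hA i j * hA.eigenvalues j) + b * ∑ j, p _ hB i j * hB.eigenvalues j := by
    intro i
    simp only [hp]
    rw [← hA.re_inner_mulVec_eq_sum, ← hB.re_inner_mulVec_eq_sum]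
    have h1 : hC.eigenvalues i = (inner ℂ (hC.eigenvectorBasis i) (WithLp.toLp 2
        (((a : ℂ) • A + (b : ℂ) • B) *ᵥ (hC.eigenvectorBasis i).ofLp))).re := by
      rw [hC.mulVec_eigenvectorBasis i]
      have : (WithLp.toLp 2 (hC.eigenvalues i • (hC.eigenvectorBasis i).ofLp) :
          EuclideanSpace ℂ ι) = ((hC.eigenvalues i : ℝ) : ℂ) • hC.eigenvectorBasis i := by
        ext k; simp
      rw [this, inner_smul_right]
      simp
    rw [h1, Matrix.add_mulVec, Matrix.smul_mulVec, Matrix.smul_mulVec, WithLp.toLp_add,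
      WithLp.toLp_smul, WithLp.toLp_smul, inner_add_right, inner_smul_right, inner_smul_right,
      Complex.add_re, Complex.re_ofReal_mul, Complex.re_ofReal_mul]
  constructor
  · intro i
    rw [heig]
    exact hf.1 (hmem hA hAS i) (hmem hB hBS i) ha hb hab
  · calc ∑ i, f (hC.eigenvalues i)
        ≤ ∑ i, (a * (∑ j, p _ hA i j * f (hA.eigenvalues j)) +
          b * ∑ j, p _ hB i j * f (hB.eigenvalues j)) := by
          refine Finset.sum_le_sum fun i _ => ?_
          rw [heig]
          refine (hf.2 (hmem hA hAS i) (hmem hB hBS i) ha hb hab).trans ?_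
          exact add_le_add (mul_le_mul_of_nonneg_left (hjen hA hAS i) ha)
            (mul_le_mul_of_nonneg_left (hjen hB hBS i) hb)
      _ = _ := by
          rw [Finset.sum_add_distrib, ← Finset.mul_sum, ← Finset.mul_sum, htot, htot]

end Eigenvalues

theorem arccot_pos (x : ℝ) : 0 < arccot x := by
  have := Real.arctan_lt_pi_div_two x
  unfold arccot; linarith

theorem convexOn_arccot : ConvexOn ℝ (Ioi 0) arccot := by
  have h : ConcaveOn ℝ (Ioi 0) Real.arctan := by
    refine AntitoneOn.concaveOn_of_deriv (convex_Ioi 0) Real.continuous_arctan.continuousOn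
      Real.differentiable_arctan.differentiableOn ?_
    rw [interior_Ioi]
    intro x hx y hy hxy
    simp only [Real.deriv_arctan]
    have hx' : (0 : ℝ) < x := hx
    gcongr
  exact (convexOn_const (Real.pi / 2) (convex_Ioi 0)).sub h

/-- All eigenvalues are positive where the phase is less than `π / 2`, and `arccot` is convex on the
positive half-line. -/
theorem lagrangianPhase_mem_Ioo_of_convex {n : ℕ} {A B : Matrix (Fin n) (Fin n) ℂ}
    (hA : A.IsHermitian) (hB : B.IsHermitian)
    (hAp : lagrangianPhase A ∈ Ioo 0 (Real.pi / 2)) (hBp : lagrangianPhase B ∈ Ioo 0 (Real.pi / 2))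
    {a b : ℝ} (ha : 0 ≤ a) (hb : 0 ≤ b) (hab : a + b = 1) :
    lagrangianPhase ((a : ℂ) • A + (b : ℂ) • B) ∈ Ioo 0 (Real.pi / 2) := by
  have hC : ((a : ℂ) • A + (b : ℂ) • B).IsHermitian := by
    apply Matrix.IsHermitian.add
    · simp [Matrix.IsHermitian, Matrix.conjTranspose_smul, hA.eq]
    · simp [Matrix.IsHermitian, Matrix.conjTranspose_smul, hB.eq]
  have hpos : ∀ {A : Matrix (Fin n) (Fin n) ℂ} (hA : A.IsHermitian),
      ∑ i, arccot (hA.eigenvalues i) < Real.pi / 2 → ∀ i, hA.eigenvalues i ∈ Ioi (0 : ℝ) := by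
    intro A hA h i
    have h1 : arccot (hA.eigenvalues i) < Real.pi / 2 :=
      (Finset.single_le_sum (f := fun i => arccot (hA.eigenvalues i))
        (fun i _ => (arccot_pos _).le) (Finset.mem_univ i)).trans_lt h
    unfold arccot at h1
    exact Real.arctan_pos.1 (by linarith)
  simp only [lagrangianPhase, dif_pos hA, dif_pos hB, dif_pos hC] at hAp hBp ⊢
  have hne : Nonempty (Fin n) := by
    by_contra h
    rw [not_nonempty_iff] at h
    simp at hAp
  have key := (hA.sum_eigenvalues_convex convexOn_arccot hB (hpos hA hAp.2) (hpos hB hBp.2)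
    ha hb hab hC).2
  refine ⟨Finset.sum_pos (fun i _ => arccot_pos _) Finset.univ_nonempty, key.trans_lt ?_⟩
  have h1 := hAp.2
  have h2 := hBp.2
  rcases ha.eq_or_lt with h0 | h0
  · rw [← h0] at hab ⊢
    have : b = 1 := by linarith
    rw [this]; linarith
  · have e1 := mul_lt_mul_of_pos_left h1 h0
    have e2 := mul_le_mul_of_nonneg_left h2.le hb
    have e3 : a * (Real.pi / 2) + b * (Real.pi / 2) = Real.pi / 2 := by rw [← add_mul, hab, one_mul]
    linarith

/-! ### Determinants and adjugates of matrix functions -/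

open scoped ComplexOrder in
/-- The eigenvalues `λ + i` of `A + i` are not zero. -/
theorem Matrix.IsHermitian.det_add_I_ne_zero {ι : Type*} [Fintype ι] [DecidableEq ι]
    {A : Matrix ι ι ℂ} (hA : A.IsHermitian) : (A + Complex.I • (1 : Matrix ι ι ℂ)).det ≠ 0 := by
  intro h
  obtain ⟨x, hx0, hx⟩ := Matrix.exists_mulVec_eq_zero_iff.2 h
  have h1 : A *ᵥ x = -Complex.I • x := by
    rw [Matrix.add_mulVec, Matrix.smul_mulVec, Matrix.one_mulVec] at hx
    rw [neg_smul]; exact eq_neg_of_add_eq_zero_left hx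
  have h2 : star x ⬝ᵥ (A *ᵥ x) = star (star x ⬝ᵥ (A *ᵥ x)) := by
    conv_lhs => rw [Matrix.star_dotProduct, Matrix.star_mulVec, hA.eq, ← Matrix.dotProduct_mulVec]
  rw [h1, dotProduct_smul, smul_eq_mul] at h2
  have h3 : star (star x ⬝ᵥ x) = star x ⬝ᵥ x := (Matrix.star_dotProduct x x).symm
  rw [star_mul', h3] at h2
  have h4 : star x ⬝ᵥ x ≠ 0 := fun h => hx0 (dotProduct_star_self_eq_zero.1 h)
  have h5 := mul_right_cancel₀ h4 h2
  simp [Complex.ext_iff] at h5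
  norm_num at h5

section Jacobi

variable {ι : Type*} [Fintype ι] [DecidableEq ι] {E : Type*} [NormedAddCommGroup E]
  [NormedSpace ℝ E]

/-- Jacobi's formula. -/
theorem HasFDerivAt.matrix_det {A : E → Matrix ι ι ℂ} {A' : ι → ι → E →L[ℝ] ℂ} {z : E}
    (hA : ∀ i j, HasFDerivAt (fun w => A w i j) (A' i j) z) :
    HasFDerivAt (fun w => (A w).det) (∑ i, ∑ j, (A z).adjugate j i • A' i j) z := by
  let d : ContinuousMultilinearMap ℂ (fun _ : ι => ι → ℂ) ℂ :=
    { (Matrix.detRowAlternating (n := ι) (R := ℂ)).toMultilinearMap with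
      cont := (continuous_id (X := Matrix ι ι ℂ)).matrix_det }
  have hd : ∀ M : ι → ι → ℂ, d M = Matrix.det (Matrix.of M) := fun M => rfl
  have h1 : HasFDerivAt d ((d.linearDeriv (A z)).restrictScalars ℝ) (A z) :=
    (d.hasFDerivAt (A z)).restrictScalars ℝ
  have h2 : HasFDerivAt (fun w => (A w : ι → ι → ℂ))
      (ContinuousLinearMap.pi fun i => ContinuousLinearMap.pi fun j => A' i j) z :=
    hasFDerivAt_pi.2 fun i => hasFDerivAt_pi.2 fun j => hA i j
  have h3 := h1.comp z h2
  refine h3.congr_fderiv ?_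
  ext v
  have h5 : d.linearDeriv (A z) (fun i j => A' i j v) =
      ∑ i, d (Function.update (A z) i fun j => A' i j v) :=
    ContinuousMultilinearMap.linearDeriv_apply ..
  refine h5.trans ?_
  simp only [sum_apply, smul_apply, smul_eq_mul]
  refine Finset.sum_congr rfl fun i _ => ?_
  have h4 : Matrix.det (Matrix.of (Function.update (A z : ι → ι → ℂ) i fun j => A' i j v)) =
      ((A z).updateRow i fun j => A' i j v).det := rfl
  refine h4.trans ?_
  rw [← Matrix.cramer_transpose_apply, Matrix.cramer_eq_adjugate_mulVec, Matrix.mulVec, dotProduct]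
  simp [← Matrix.adjugate_transpose]

theorem HasDerivAt.matrix_det {A : ℝ → Matrix ι ι ℂ} {A' : Matrix ι ι ℂ} {t : ℝ}
    (hA : ∀ i j, HasDerivAt (fun s => A s i j) (A' i j) t) :
    HasDerivAt (fun s => (A s).det) ((A t).adjugate * A').trace t := by
  have h := (HasFDerivAt.matrix_det fun i j => (hA i j).hasFDerivAt).hasDerivAt
  convert h using 1
  simp [Matrix.trace, Matrix.mul_apply]
  exact Finset.sum_comm

end Jacobi

/-- Algebraic form of the fact that the cofactor matrix of a Jacobian is divergence free. Here
`X j` and `B' j` stand for the `j`-th derivatives of `M` and of its adjugate. -/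
theorem Matrix.sum_deriv_adjugate_eq_zero {ι : Type*} [Fintype ι] [DecidableEq ι]
    {M : Matrix ι ι ℂ} (hM : M.det ≠ 0) {X B' : ι → Matrix ι ι ℂ}
    (hX : ∀ a b j, X j a b = X a j b)
    (hB : ∀ j, X j * M.adjugate + M * B' j = (M.adjugate * X j).trace • (1 : Matrix ι ι ℂ))
    (k : ι) :
    ∑ j, B' j k j = 0 := by
  have hv : M *ᵥ (fun k => ∑ j, B' j k j) = 0 := by
    funext a
    have h1 : (M *ᵥ (fun k => ∑ j, B' j k j)) a = ∑ j, (M * B' j) a j := by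
      simp only [Matrix.mulVec, dotProduct, Matrix.mul_apply, Finset.mul_sum]
      exact Finset.sum_comm
    have h2 : ∀ j, (M * B' j) a j =
        (if a = j then (M.adjugate * X j).trace else 0) - (X j * M.adjugate) a j := by
      intro j
      have := congrFun (congrFun (hB j) a) j
      simp only [Matrix.add_apply, Matrix.smul_apply, Matrix.one_apply, smul_eq_mul, mul_ite,
        mul_one, mul_zero] at this
      rw [← this]; ring
    rw [h1]
    simp only [h2, Finset.sum_sub_distrib, Finset.sum_ite_eq, Finset.mem_univ, if_true,
      Pi.zero_apply, sub_eq_zero]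
    rw [Matrix.trace_mul_comm, Matrix.trace]
    refine Finset.sum_congr rfl fun j _ => ?_
    simp only [Matrix.diag_apply, Matrix.mul_apply]
    exact Finset.sum_congr rfl fun b _ => by rw [hX a b j]
  exact congrFun (Matrix.eq_zero_of_mulVec_eq_zero hM hv) k

/-! ### Families of functions which are smooth up to the boundary -/

section SmoothUpTo

variable {T T' E F F' : Type*} [NormedAddCommGroup T] [NormedSpace ℝ T] [NormedAddCommGroup T']
  [NormedSpace ℝ T'] [NormedAddCommGroup E] [NormedSpace ℝ E] [NormedAddCommGroup F]
  [NormedSpace ℝ F] [NormedAddCommGroup F'] [NormedSpace ℝ F']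

/-- The family `(f t)`, with parameters `t ∈ J`, of functions on `Ω` extends smoothly to
`J × closure Ω`. Only the values on `J × Ω` matter, so that the derivatives in `Ω` of such a family
are such families. A single function is treated as a constant family. -/
def SmoothUpTo (J : Set T) (Ω : Set E) (f : T → E → F) : Prop :=
  ∃ G : T × E → F, ContDiffOn ℝ ∞ G (J ×ˢ closure Ω) ∧ ∀ t ∈ J, ∀ z ∈ Ω, f t z = G (t, z)

namespace SmoothUpTo

variable {J : Set T} {Ω : Set E} {f : T → E → F}

theorem of_contDiffOn (hf : ContDiffOn ℝ ∞ (Function.uncurry f) (J ×ˢ closure Ω)) :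
    SmoothUpTo J Ω f := ⟨_, hf, fun _ _ _ _ => rfl⟩

theorem const_of_contDiffOn {g : E → F} (hg : ContDiffOn ℝ ∞ g (closure Ω)) :
    SmoothUpTo J Ω fun _ => g :=
  of_contDiffOn (hg.comp contDiffOn_snd fun _ hp => hp.2)

theorem const (c : F) : SmoothUpTo J Ω fun _ _ => c := const_of_contDiffOn contDiffOn_const

theorem congr {g : T → E → F} (hf : SmoothUpTo J Ω f) (h : ∀ t ∈ J, ∀ z ∈ Ω, g t z = f t z) :
    SmoothUpTo J Ω g := by
  obtain ⟨G, hG, hfG⟩ := hf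
  exact ⟨G, hG, fun t ht z hz => (h t ht z hz).trans (hfG t ht z hz)⟩

theorem reparam (hf : SmoothUpTo J Ω f) {J' : Set T'} {γ : T' → T} (hγ : ContDiff ℝ ∞ γ)
    (hγJ : MapsTo γ J' J) : SmoothUpTo J' Ω fun t => f (γ t) := by
  obtain ⟨G, hG, hfG⟩ := hf
  refine ⟨fun p => G (γ p.1, p.2), hG.comp ((hγ.comp contDiff_fst).prodMk
    contDiff_snd).contDiffOn fun p hp => ⟨hγJ hp.1, hp.2⟩, fun t ht z hz => hfG _ (hγJ ht) z hz⟩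

theorem slice (hf : SmoothUpTo J Ω f) {t : T} (ht : t ∈ J) (J' : Set T') :
    SmoothUpTo J' Ω fun _ => f t :=
  hf.reparam contDiff_const fun _ _ => ht

theorem comp_contDiff (hf : SmoothUpTo J Ω f) {g : F → F'} (hg : ContDiff ℝ ∞ g) :
    SmoothUpTo J Ω fun t z => g (f t z) := by
  obtain ⟨G, hG, hfG⟩ := hf
  exact ⟨fun p => g (G p), hg.comp_contDiffOn hG, fun t ht z hz => congrArg g (hfG t ht z hz)⟩

theorem prodMk {g : T → E → F'} (hf : SmoothUpTo J Ω f) (hg : SmoothUpTo J Ω g) :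
    SmoothUpTo J Ω fun t z => (f t z, g t z) := by
  obtain ⟨F₁, hF, hf⟩ := hf
  obtain ⟨G₁, hG, hg⟩ := hg
  exact ⟨fun p => (F₁ p, G₁ p), hF.prodMk hG, fun t ht z hz =>
    Prod.ext (hf t ht z hz) (hg t ht z hz)⟩

theorem add {g : T → E → F} (hf : SmoothUpTo J Ω f) (hg : SmoothUpTo J Ω g) :
    SmoothUpTo J Ω fun t z => f t z + g t z :=
  (hf.prodMk hg).comp_contDiff contDiff_add

theorem sub {g : T → E → F} (hf : SmoothUpTo J Ω f) (hg : SmoothUpTo J Ω g) :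
    SmoothUpTo J Ω fun t z => f t z - g t z :=
  (hf.prodMk hg).comp_contDiff (contDiff_fst.sub contDiff_snd)

theorem mul {f g : T → E → ℂ} (hf : SmoothUpTo J Ω f) (hg : SmoothUpTo J Ω g) :
    SmoothUpTo J Ω fun t z => f t z * g t z :=
  (hf.prodMk hg).comp_contDiff (contDiff_fst.mul contDiff_snd)

theorem sum {ι : Type*} (s : Finset ι) {f : ι → T → E → F} (hf : ∀ i, SmoothUpTo J Ω (f i)) :
    SmoothUpTo J Ω fun t z => ∑ i ∈ s, f i t z := by
  classical
  induction s using Finset.induction_on with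
  | empty => simpa using const (0 : F)
  | insert i s hi ih => simpa [Finset.sum_insert hi] using (hf i).add ih

theorem prod {ι : Type*} (s : Finset ι) {f : ι → T → E → ℂ} (hf : ∀ i, SmoothUpTo J Ω (f i)) :
    SmoothUpTo J Ω fun t z => ∏ i ∈ s, f i t z := by
  classical
  induction s using Finset.induction_on with
  | empty => simpa using const (1 : ℂ)
  | insert i s hi ih => simpa [Finset.prod_insert hi] using (hf i).mul ih

theorem matrix_det {ι : Type*} [Fintype ι] [DecidableEq ι] {A : T → E → Matrix ι ι ℂ}
    (hA : ∀ i j, SmoothUpTo J Ω fun t z => A t z i j) :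
    SmoothUpTo J Ω fun t z => (A t z).det := by
  simp only [Matrix.det_apply']
  exact sum _ fun σ => (const _).mul (prod _ fun i => hA _ _)

theorem matrix_adjugate {ι : Type*} [Fintype ι] [DecidableEq ι] {A : T → E → Matrix ι ι ℂ}
    (hA : ∀ i j, SmoothUpTo J Ω fun t z => A t z i j) (i j : ι) :
    SmoothUpTo J Ω fun t z => (A t z).adjugate i j := by
  simp only [Matrix.adjugate_apply]
  refine matrix_det fun k l => ?_
  by_cases hk : k = j
  · subst hk
    simpa using const _
  · simpa [Matrix.updateRow_ne hk] using hA k l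

theorem continuousOn (hf : SmoothUpTo J Ω f) : ContinuousOn (Function.uncurry f) (J ×ˢ Ω) := by
  obtain ⟨G, hG, hfG⟩ := hf
  exact (hG.continuousOn.mono (prod_mono_right subset_closure)).congr
    fun p hp => hfG p.1 hp.1 p.2 hp.2

theorem contDiffAt (hf : SmoothUpTo J Ω f) (hΩ : IsOpen Ω) {t : T} (ht : t ∈ J) {z : E}
    (hz : z ∈ Ω) : ContDiffAt ℝ ∞ (f t) z := by
  obtain ⟨G, hG, hfG⟩ := hf
  have h1 : ContDiffOn ℝ ∞ (fun w => G (t, w)) Ω :=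
    hG.comp (contDiffOn_const.prodMk contDiffOn_id) fun w hw => ⟨ht, subset_closure hw⟩
  exact (h1.congr fun w hw => hfG t ht w hw).contDiffAt (hΩ.mem_nhds hz)

theorem differentiableAt (hf : SmoothUpTo J Ω f) (hΩ : IsOpen Ω) {t : T} (ht : t ∈ J) {z : E}
    (hz : z ∈ Ω) : DifferentiableAt ℝ (f t) z :=
  (hf.contDiffAt hΩ ht hz).differentiableAt (by simp)

theorem exists_bound [ProperSpace E] (hf : SmoothUpTo J Ω f) (hJ : IsCompact J)
    (hb : Bornology.IsBounded Ω) : ∃ C, 0 ≤ C ∧ ∀ t ∈ J, ∀ z ∈ Ω, ‖f t z‖ ≤ C := by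
  obtain ⟨G, hG, hfG⟩ := hf
  obtain ⟨C, hC⟩ := (hJ.prod hb.isCompact_closure).exists_bound_of_continuousOn hG.continuousOn
  refine ⟨max C 0, le_max_right _ _, fun t ht z hz => ?_⟩
  rw [hfG t ht z hz]
  exact (hC _ ⟨ht, subset_closure hz⟩).trans (le_max_left _ _)

protected theorem fderiv (hf : SmoothUpTo J Ω f) (hΩ : IsOpen Ω)
    (hu : UniqueDiffOn ℝ (closure Ω)) : SmoothUpTo J Ω fun t => fderiv ℝ (f t) := by
  obtain ⟨G, hG, hfG⟩ := hf
  refine ⟨fun p => fderivWithin ℝ (fun w => G (p.1, w)) (closure Ω) p.2, fun p hp => ?_,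
    fun t ht z hz => ?_⟩
  · refine ContDiffWithinAt.fderivWithin (n := ∞) (f := fun (q : T × E) w => G (q.1, w))
      (g := Prod.snd) ?_ contDiffWithinAt_snd hu (by simp) hp fun q hq => hq.2
    have h := hG p hp
    refine ContDiffWithinAt.comp (t := J ×ˢ closure Ω) (g := G)
      (f := fun q : (T × E) × E => (q.1.1, q.2)) (p, p.2) h ?_ ?_
    · exact (contDiff_fst.fst.prodMk contDiff_snd).contDiffWithinAt
    · exact fun q hq => ⟨hq.1.1, hq.2⟩
  · have h1 : fderiv ℝ (f t) z = fderiv ℝ (fun w => G (t, w)) z := by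
      apply Filter.EventuallyEq.fderiv_eq
      filter_upwards [hΩ.mem_nhds hz] with w hw using hfG t ht w hw
    refine h1.trans ?_
    dsimp only
    rw [fderivWithin_of_mem_nhds (Filter.mem_of_superset (hΩ.mem_nhds hz) subset_closure)]

protected theorem derivWithin {J : Set ℝ} {f : ℝ → E → F} (hf : SmoothUpTo J Ω f)
    (hJ : UniqueDiffOn ℝ J) :
    SmoothUpTo J Ω fun t z => derivWithin (fun r => f r z) J t := by
  obtain ⟨G, hG, hfG⟩ := hf
  refine ⟨fun p => fderivWithin ℝ (fun r => G (r, p.2)) J p.1 1, fun p hp => ?_,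
    fun t ht z hz => ?_⟩
  · refine ContDiffWithinAt.fderivWithin_apply (n := ∞) (f := fun (q : ℝ × E) r => G (r, q.2))
      (g := Prod.fst) (k := fun _ => 1) ?_ contDiffWithinAt_fst contDiffWithinAt_const hJ
      (by simp) hp fun q hq => hq.1
    have h := hG p hp
    refine ContDiffWithinAt.comp (t := J ×ˢ closure Ω) (g := G)
      (f := fun q : (ℝ × E) × ℝ => (q.2, q.1.2)) (p, p.1) h ?_ ?_
    · exact (contDiff_snd.prodMk contDiff_fst.snd).contDiffWithinAt
    · exact fun q hq => ⟨hq.2, hq.1.2⟩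
  · exact derivWithin_congr (fun r hr => hfG r hr z hz) (hfG t ht z hz)

theorem hasDerivWithinAt {J : Set ℝ} {f : ℝ → E → F} (hf : SmoothUpTo J Ω f)
    {t : ℝ} (ht : t ∈ J) {z : E} (hz : z ∈ Ω) :
    HasDerivWithinAt (fun r => f r z) (derivWithin (fun r => f r z) J t) J t := by
  obtain ⟨G, hG, hfG⟩ := hf
  have h1 : ContDiffOn ℝ ∞ (fun r => G (r, z)) J :=
    hG.comp (contDiffOn_id.prodMk contDiffOn_const) fun r hr => ⟨hr, subset_closure hz⟩
  have h2 : ContDiffOn ℝ ∞ (fun r => f r z) J := h1.congr fun r hr => hfG r hr z hz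
  exact ((h2.differentiableOn (by simp)) t ht).hasDerivWithinAt

/-- The difference quotients in the parameter are uniformly bounded. -/
theorem exists_lipschitz [ProperSpace E] {J : Set ℝ} {f : ℝ → E → F} (hf : SmoothUpTo J Ω f)
    (hJ : IsCompact J)
    (hJ' : UniqueDiffOn ℝ J) (hJc : Convex ℝ J) (hb : Bornology.IsBounded Ω) :
    ∃ C, 0 ≤ C ∧ ∀ t ∈ J, ∀ r ∈ J, ∀ z ∈ Ω, ‖f r z - f t z‖ ≤ C * ‖r - t‖ := by
  obtain ⟨C, hC0, hC⟩ := (hf.derivWithin hJ').exists_bound hJ hb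
  refine ⟨C, hC0, fun t ht r hr z hz => ?_⟩
  exact hJc.norm_image_sub_le_of_norm_hasDerivWithin_le
    (fun x hx => hf.hasDerivWithinAt hx hz) (fun x hx => hC x hx z hz) ht hr

end SmoothUpTo

/-! ### Complex vector fields with constant coefficients -/

/-- The complex vector field `(∂_X + ε ∂_Y) / 2`. The Wirtinger derivatives are of this kind. -/
noncomputable def cderiv (X Y : E) (ε : ℂ) (f : E → ℂ) (z : E) : ℂ :=
  (1 / 2 : ℂ) * (fderiv ℝ f z X + ε * fderiv ℝ f z Y)

variable {X Y X' Y' : E} {ε ε' : ℂ} {f g : E → ℂ} {z : E}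

theorem cderiv_congr {Ω : Set E} (hΩ : IsOpen Ω) (h : EqOn f g Ω) (hz : z ∈ Ω) :
    cderiv X Y ε f z = cderiv X Y ε g z := by
  have : f =ᶠ[nhds z] g := Filter.mem_of_superset (hΩ.mem_nhds hz) h
  rw [cderiv, cderiv, this.fderiv_eq]

theorem cderiv_of_hasFDerivAt {f' : E →L[ℝ] ℂ} (h : HasFDerivAt f f' z) :
    cderiv X Y ε f z = (1 / 2 : ℂ) * (f' X + ε * f' Y) := by rw [cderiv, h.fderiv]

theorem cderiv_const (c : ℂ) : cderiv X Y ε (fun _ => c) z = 0 := by simp [cderiv]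

theorem cderiv_add (hf : DifferentiableAt ℝ f z) (hg : DifferentiableAt ℝ g z) :
    cderiv X Y ε (fun w => f w + g w) z = cderiv X Y ε f z + cderiv X Y ε g z := by
  rw [cderiv_of_hasFDerivAt (hf.hasFDerivAt.fun_add hg.hasFDerivAt), cderiv, cderiv]
  simp; ring

theorem cderiv_mul (hf : DifferentiableAt ℝ f z) (hg : DifferentiableAt ℝ g z) :
    cderiv X Y ε (fun w => f w * g w) z = f z * cderiv X Y ε g z + cderiv X Y ε f z * g z := by
  rw [cderiv_of_hasFDerivAt (hf.hasFDerivAt.fun_mul hg.hasFDerivAt), cderiv, cderiv]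
  simp; ring

theorem cderiv_const_mul (c : ℂ) (hf : DifferentiableAt ℝ f z) :
    cderiv X Y ε (fun w => c * f w) z = c * cderiv X Y ε f z := by
  rw [cderiv_mul (differentiableAt_const c) hf, cderiv_const, zero_mul, add_zero]

theorem cderiv_sum {ι : Type*} (s : Finset ι) {f : ι → E → ℂ}
    (hf : ∀ i, DifferentiableAt ℝ (f i) z) :
    cderiv X Y ε (fun w => ∑ i ∈ s, f i w) z = ∑ i ∈ s, cderiv X Y ε (f i) z := by
  rw [cderiv_of_hasFDerivAt (HasFDerivAt.fun_sum fun i _ => (hf i).hasFDerivAt)]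
  simp only [cderiv, sum_apply, Finset.mul_sum, ← Finset.sum_add_distrib]

theorem cderiv_comm (hf : ContDiffAt ℝ 2 f z) :
    cderiv X Y ε (cderiv X' Y' ε' f) z = cderiv X' Y' ε' (cderiv X Y ε f) z := by
  have hsymm : IsSymmSndFDerivAt ℝ f z := hf.isSymmSndFDerivAt (by simp)
  have hD : HasFDerivAt (fderiv ℝ f) (fderiv ℝ (fderiv ℝ f) z) z :=
    ((hf.fderiv_right (m := 1) (by norm_num)).differentiableAt (by norm_num)).hasFDerivAt
  have h1 : ∀ v : E, HasFDerivAt (fun w => fderiv ℝ f w v)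
      ((ContinuousLinearMap.apply ℝ ℂ v) ∘L fderiv ℝ (fderiv ℝ f) z) z :=
    fun v => (ContinuousLinearMap.apply ℝ ℂ v).hasFDerivAt.comp z hD
  have h2 : ∀ (X Y : E) (ε : ℂ), HasFDerivAt (cderiv X Y ε f) _ z := fun X Y ε =>
    ((h1 X).fun_add ((h1 Y).const_mul ε)).const_mul (1 / 2 : ℂ)
  rw [cderiv_of_hasFDerivAt (h2 X' Y' ε'), cderiv_of_hasFDerivAt (h2 X Y ε)]
  simp only [smul_apply, add_apply, ContinuousLinearMap.comp_apply,
    ContinuousLinearMap.apply_apply, smul_eq_mul]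
  rw [hsymm.eq X X', hsymm.eq X Y', hsymm.eq Y X', hsymm.eq Y Y']
  ring

protected theorem SmoothUpTo.cderiv {J : Set T} {Ω : Set E} {f : T → E → ℂ} (hf : SmoothUpTo J Ω f)
    (hΩ : IsOpen Ω) (hu : UniqueDiffOn ℝ (closure Ω)) :
    SmoothUpTo J Ω fun t => cderiv X Y ε (f t) := by
  have h := hf.fderiv hΩ hu
  have h1 : ∀ v : E, SmoothUpTo J Ω fun t z => fderiv ℝ (f t) z v := fun v =>
    h.comp_contDiff (g := fun L : E →L[ℝ] ℂ => L v) (by fun_prop)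
  exact (SmoothUpTo.const _).mul ((h1 X).add ((SmoothUpTo.const ε).mul (h1 Y)))

variable [FiniteDimensional ℝ E] [MeasurableSpace E] [BorelSpace E]

theorem SmoothUpTo.integrableOn {μ : Measure E} [IsFiniteMeasureOnCompacts μ]
    {J : Set T} {Ω : Set E} {f : T → E → ℂ} (hf : SmoothUpTo J Ω f) (hΩ : IsOpen Ω)
    (hb : Bornology.IsBounded Ω) {t : T} (ht : t ∈ J) : IntegrableOn (f t) Ω μ := by
  have : ProperSpace E := FiniteDimensional.proper ℝ E
  obtain ⟨C, -, hC⟩ := (hf.slice ht {t}).exists_bound isCompact_singleton hb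
  have hfin : μ Ω ≠ ⊤ := ((measure_mono subset_closure).trans_lt
    hb.isCompact_closure.measure_lt_top).ne
  have : IsFiniteMeasure (μ.restrict Ω) := ⟨by simpa using hfin.lt_top⟩
  have hc : ContinuousOn (f t) Ω := fun z hz =>
    (hf.differentiableAt hΩ ht hz).continuousAt.continuousWithinAt
  exact Integrable.of_bound (hc.aestronglyMeasurable hΩ.measurableSet) C
    ((ae_restrict_iff' hΩ.measurableSet).2 (.of_forall fun z hz => hC t rfl z hz))

/-- The family is integrable jointly in the parameter and the point. -/
theorem SmoothUpTo.integrableOn_prod {μ : Measure E} [IsFiniteMeasureOnCompacts μ] [SFinite μ]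
    {J : Set ℝ} {Ω : Set E} {f : ℝ → E → ℂ} (hf : SmoothUpTo J Ω f) (hJ : IsCompact J)
    (hΩ : IsOpen Ω) (hb : Bornology.IsBounded Ω) :
    IntegrableOn (fun p : ℝ × E => f p.1 p.2) (J ×ˢ Ω) (volume.prod μ) := by
  have : ProperSpace E := FiniteDimensional.proper ℝ E
  obtain ⟨C, -, hC⟩ := hf.exists_bound hJ hb
  have hms : MeasurableSet (J ×ˢ Ω) := hJ.measurableSet.prod hΩ.measurableSet
  have hfin : (volume.prod μ) (J ×ˢ Ω) < ⊤ := by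
    rw [Measure.prod_prod]
    exact ENNReal.mul_lt_top hJ.measure_lt_top
      ((measure_mono subset_closure).trans_lt hb.isCompact_closure.measure_lt_top)
  have : IsFiniteMeasure ((volume.prod μ).restrict (J ×ˢ Ω)) := ⟨by simpa using hfin⟩
  exact Integrable.of_bound (hf.continuousOn.aestronglyMeasurable hms) C
    ((ae_restrict_iff' hms).2 (.of_forall fun p hp => hC p.1 hp.1 p.2 hp.2))

variable {μ : Measure E} [μ.IsAddHaarMeasure]

/-- The integral of a derivative of `f V` vanishes when `f` does on the boundary. -/
theorem setIntegral_fderiv_mul_eq_zero {J : Set ℝ} {Ω : Set E} (hΩ : IsOpen Ω)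
    (hne : Ω ≠ univ) (hb : Bornology.IsBounded Ω) (hu : UniqueDiffOn ℝ (closure Ω))
    {f : E → ℝ} (hf : ContDiffOn ℝ ∞ f (closure Ω)) (hf0 : ∀ z ∈ frontier Ω, f z = 0)
    {V : E → ℂ} (hJ : J.Nonempty) (hV : SmoothUpTo J Ω fun _ => V) (v : E) :
    ∫ z in Ω, fderiv ℝ (fun w => (f w : ℂ) * V w) z v ∂μ = 0 := by
  have : ProperSpace E := FiniteDimensional.proper ℝ E
  obtain ⟨t, ht⟩ := hJ
  have hfc : SmoothUpTo J Ω fun _ z => (f z : ℂ) :=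
    (SmoothUpTo.const_of_contDiffOn hf).comp_contDiff Complex.ofRealCLM.contDiff
  have hP := (hfc.mul hV).slice ht {t}
  obtain ⟨C, hC0, hC⟩ := (hP.fderiv hΩ hu).exists_bound isCompact_singleton hb
  obtain ⟨D, hD0, hD⟩ := (hV.slice ht {t}).exists_bound isCompact_singleton hb
  have hcont : Continuous (indicator Ω f) := continuous_indicator hf0 hf.continuousOn
  -- It suffices to treat the real and imaginary parts, continued by zero.
  have key : ∀ L : ℂ →L[ℝ] ℝ, L (∫ z in Ω, fderiv ℝ (fun w => (f w : ℂ) * V w) z v ∂μ) = 0 := by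
    intro L
    set W : E → ℝ := indicator Ω fun w => L ((f w : ℂ) * V w) with hWdef
    have hWeq : ∀ z ∈ Ω, W =ᶠ[nhds z] fun w => L ((f w : ℂ) * V w) := fun z hz => by
      filter_upwards [hΩ.mem_nhds hz] with w hw using indicator_of_mem hw _
    have hWd : ∀ z ∈ Ω, HasFDerivAt W (L ∘L fderiv ℝ (fun w => (f w : ℂ) * V w) z) z :=
      fun z hz => (L.hasFDerivAt.comp z
        (hP.differentiableAt hΩ rfl hz).hasFDerivAt).congr_of_eventuallyEq (hWeq z hz)
    have hW0 : ∀ z ∉ Ω, W z = 0 := fun z hz => indicator_of_notMem hz _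
    have hWbound : ∀ w, ‖W w‖ ≤ ‖L‖ * D * ‖indicator Ω f w‖ := by
      intro w
      by_cases hw : w ∈ Ω
      · rw [hWdef, indicator_of_mem hw, indicator_of_mem hw]
        refine (L.le_opNorm _).trans ?_
        rw [norm_mul, Complex.norm_real, mul_assoc, mul_comm D]
        gcongr
        exact hD t rfl w hw
      · rw [hW0 w hw, indicator_of_notMem hw]; simp
    have hWc : Continuous W := by
      rw [continuous_iff_continuousAt]
      intro x
      by_cases hx : x ∈ Ω
      · exact (hWd x hx).continuousAt
      · rw [ContinuousAt, hW0 x hx]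
        refine squeeze_zero_norm hWbound ?_
        have h1 : Filter.Tendsto (fun w => ‖L‖ * D * ‖indicator Ω f w‖) (nhds x)
            (nhds (‖L‖ * D * ‖indicator Ω f x‖)) :=
          (continuous_const.mul hcont.norm).tendsto x
        rwa [indicator_of_notMem hx, norm_zero, mul_zero] at h1
    have hzero := setIntegral_fderiv_eq_zero_of_eq_zero (μ := μ) hΩ hne hb hWc hW0
      (fun z hz => (hWd z hz).differentiableAt) (C := ‖L‖ * C) (fun z hz => by
        rw [(hWd z hz).fderiv]
        exact (L.opNorm_comp_le _).trans (mul_le_mul_of_nonneg_left (hC t rfl z hz)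
          (norm_nonneg _))) v
    have hint : IntegrableOn (fun z => fderiv ℝ (fun w => (f w : ℂ) * V w) z v) Ω μ :=
      ((hP.fderiv hΩ hu).comp_contDiff (g := fun L : E →L[ℝ] ℂ => L v)
        (by fun_prop)).integrableOn hΩ hb (mem_singleton t)
    rw [← L.integral_comp_comm hint, ← hzero]
    refine setIntegral_congr_fun hΩ.measurableSet fun z hz => ?_
    simp only [(hWd z hz).fderiv, ContinuousLinearMap.comp_apply]
  exact Complex.ext (key Complex.reCLM) (key Complex.imCLM)

theorem setIntegral_mul_cderiv {J : Set ℝ} {Ω : Set E} (hΩ : IsOpen Ω)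
    (hne : Ω ≠ univ) (hb : Bornology.IsBounded Ω) (hu : UniqueDiffOn ℝ (closure Ω))
    {f : E → ℝ} (hf : ContDiffOn ℝ ∞ f (closure Ω)) (hf0 : ∀ z ∈ frontier Ω, f z = 0)
    {V : E → ℂ} (hJ : J.Nonempty) (hV : SmoothUpTo J Ω fun _ => V) :
    ∫ z in Ω, (f z : ℂ) * cderiv X Y ε V z ∂μ =
      -∫ z in Ω, cderiv X Y ε (fun w => (f w : ℂ)) z * V z ∂μ := by
  obtain ⟨t, ht⟩ := hJ
  have hfc : SmoothUpTo J Ω fun _ z => (f z : ℂ) :=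
    (SmoothUpTo.const_of_contDiffOn hf).comp_contDiff Complex.ofRealCLM.contDiff
  have hint : ∀ v, IntegrableOn (fun z => fderiv ℝ (fun w => (f w : ℂ) * V w) z v) Ω μ := fun v =>
    (((hfc.mul hV).fderiv hΩ hu).comp_contDiff (g := fun L : E →L[ℝ] ℂ => L v)
      (by fun_prop)).integrableOn hΩ hb ht
  have h1 : ∫ z in Ω, cderiv X Y ε (fun w => (f w : ℂ) * V w) z ∂μ = 0 := by
    simp only [cderiv]
    rw [integral_const_mul, integral_add (hint X) ((hint Y).const_mul ε), integral_const_mul,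
      setIntegral_fderiv_mul_eq_zero hΩ hne hb hu hf hf0 ⟨t, ht⟩ hV,
      setIntegral_fderiv_mul_eq_zero hΩ hne hb hu hf hf0 ⟨t, ht⟩ hV]
    simp
  rw [eq_neg_iff_add_eq_zero, ← h1, ← integral_add]
  · refine setIntegral_congr_fun hΩ.measurableSet fun z hz => ?_
    exact (cderiv_mul (hfc.differentiableAt hΩ ht hz) (hV.differentiableAt hΩ ht hz)).symm
  · exact (hfc.mul (hV.cderiv hΩ hu)).integrableOn hΩ hb ht
  · exact ((hfc.cderiv hΩ hu).mul hV).integrableOn hΩ hb ht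

end SmoothUpTo

/-! ### The adjugate of a Jacobian is divergence free -/

section Piola

variable {ι E : Type*} [Fintype ι] [DecidableEq ι] [NormedAddCommGroup E] [NormedSpace ℝ E]

theorem cderiv_matrix_det {X Y : E} {ε : ℂ} {M : E → Matrix ι ι ℂ} {z : E}
    (hM : ∀ a b, DifferentiableAt ℝ (fun w => M w a b) z) :
    cderiv X Y ε (fun w => (M w).det) z =
      ((M z).adjugate * Matrix.of fun a b => cderiv X Y ε (fun w => M w a b) z).trace := by
  rw [cderiv_of_hasFDerivAt (HasFDerivAt.matrix_det fun a b => (hM a b).hasFDerivAt),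
    Matrix.trace_mul_comm]
  simp only [Matrix.trace, Matrix.diag_apply, Matrix.mul_apply, Matrix.of_apply, cderiv, sum_apply,
    smul_apply, smul_eq_mul, Finset.mul_sum, ← Finset.sum_add_distrib]
  refine Finset.sum_congr rfl fun a _ => Finset.sum_congr rfl fun b _ => ?_
  ring

/-- Piola's identity, for an invertible matrix of functions whose columns are gradients. -/
theorem sum_cderiv_adjugate_eq_zero {X Y : ι → E} {ε : ℂ} {M : E → Matrix ι ι ℂ} {z : E}
    (hM : ∀ a b, DifferentiableAt ℝ (fun w => M w a b) z)
    (hA : ∀ a b, DifferentiableAt ℝ (fun w => (M w).adjugate a b) z) (hdet : (M z).det ≠ 0)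
    (hX : ∀ a b j, cderiv (X j) (Y j) ε (fun w => M w a b) z =
      cderiv (X a) (Y a) ε (fun w => M w j b) z) (k : ι) :
    ∑ j, cderiv (X j) (Y j) ε (fun w => (M w).adjugate k j) z = 0 := by
  refine Matrix.sum_deriv_adjugate_eq_zero hdet
    (X := fun j => Matrix.of fun a b => cderiv (X j) (Y j) ε (fun w => M w a b) z)
    (B' := fun j => Matrix.of fun a b => cderiv (X j) (Y j) ε (fun w => (M w).adjugate a b) z)
    hX (fun j => ?_) k
  ext a b
  have hd : DifferentiableAt ℝ (fun w => (M w).det) z :=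
    (HasFDerivAt.matrix_det fun a b => (hM a b).hasFDerivAt).differentiableAt
  have h1 : (fun w => ∑ c, M w a c * (M w).adjugate c b) =
      fun w => (1 : Matrix ι ι ℂ) a b * (M w).det := by
    funext w
    rw [← Matrix.mul_apply, Matrix.mul_adjugate, Matrix.smul_apply, smul_eq_mul, mul_comm]
  have h2 : cderiv (X j) (Y j) ε (fun w => ∑ c, M w a c * (M w).adjugate c b) z =
      cderiv (X j) (Y j) ε (fun w => (1 : Matrix ι ι ℂ) a b * (M w).det) z :=
    congrArg (fun F => cderiv (X j) (Y j) ε F z) h1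
  rw [cderiv_sum _ fun c => (hM a c).fun_mul (hA c b), cderiv_const_mul _ hd,
    cderiv_matrix_det hM] at h2
  simp only [Matrix.add_apply, Matrix.smul_apply, smul_eq_mul]
  rw [mul_comm _ ((1 : Matrix ι ι ℂ) a b), ← h2, Matrix.mul_apply, Matrix.mul_apply,
    ← Finset.sum_add_distrib]
  refine Finset.sum_congr rfl fun c _ => ?_
  rw [cderiv_mul (hM a c) (hA c b)]
  simp only [Matrix.of_apply]
  ring

end Piola

section

variable {ι E : Type*} [Fintype ι] [NormedAddCommGroup E] [NormedSpace ℝ E]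
  [FiniteDimensional ℝ E] [MeasurableSpace E] [BorelSpace E] {μ : Measure E} [μ.IsAddHaarMeasure]

/-- Integration by parts against a divergence-free matrix of coefficients. -/
theorem setIntegral_mul_sum_cderiv {J : Set ℝ} {Ω : Set E} (hΩ : IsOpen Ω)
    (hne : Ω ≠ univ) (hb : Bornology.IsBounded Ω) (hu : UniqueDiffOn ℝ (closure Ω))
    {f : E → ℝ} (hf : ContDiffOn ℝ ∞ f (closure Ω)) (hf0 : ∀ z ∈ frontier Ω, f z = 0)
    (hJ : J.Nonempty) {X Y : ι → E} {ε : ℂ} {B : ι → ι → E → ℂ}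
    (hB : ∀ k j, SmoothUpTo J Ω fun _ => B k j)
    (hdiv : ∀ k, ∀ z ∈ Ω, ∑ j, cderiv (X j) (Y j) ε (B k j) z = 0)
    {V : ι → E → ℂ} (hV : ∀ k, SmoothUpTo J Ω fun _ => V k) :
    ∫ z in Ω, (f z : ℂ) * ∑ k, ∑ j, B k j z * cderiv (X j) (Y j) ε (V k) z ∂μ =
      -∫ z in Ω, ∑ k, ∑ j, cderiv (X j) (Y j) ε (fun w => (f w : ℂ)) z * (B k j z * V k z) ∂μ := by
  obtain ⟨t, ht⟩ := hJ
  have hfc : SmoothUpTo J Ω fun _ z => (f z : ℂ) :=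
    (SmoothUpTo.const_of_contDiffOn hf).comp_contDiff Complex.ofRealCLM.contDiff
  have hBV : ∀ k j, SmoothUpTo J Ω fun _ z => B k j z * V k z := fun k j => (hB k j).mul (hV k)
  have h1 : ∀ z ∈ Ω, (f z : ℂ) * ∑ k, ∑ j, B k j z * cderiv (X j) (Y j) ε (V k) z =
      ∑ k, ∑ j, (f z : ℂ) * cderiv (X j) (Y j) ε (fun w => B k j w * V k w) z := by
    intro z hz
    rw [Finset.mul_sum]
    refine Finset.sum_congr rfl fun k _ => ?_
    rw [← Finset.mul_sum]
    congr 1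
    have h2 : ∀ j, cderiv (X j) (Y j) ε (fun w => B k j w * V k w) z =
        B k j z * cderiv (X j) (Y j) ε (V k) z + cderiv (X j) (Y j) ε (B k j) z * V k z :=
      fun j => cderiv_mul ((hB k j).differentiableAt hΩ ht hz) ((hV k).differentiableAt hΩ ht hz)
    simp only [h2, Finset.sum_add_distrib, ← Finset.sum_mul, hdiv k z hz, zero_mul, add_zero]
  have hi1 : ∀ k j, IntegrableOn
      (fun z => (f z : ℂ) * cderiv (X j) (Y j) ε (fun w => B k j w * V k w) z) Ω μ := fun k j =>
    (hfc.mul ((hBV k j).cderiv hΩ hu)).integrableOn hΩ hb ht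
  have hi2 : ∀ k j, IntegrableOn
      (fun z => cderiv (X j) (Y j) ε (fun w => (f w : ℂ)) z * (B k j z * V k z)) Ω μ := fun k j =>
    ((hfc.cderiv hΩ hu).mul (hBV k j)).integrableOn hΩ hb ht
  rw [setIntegral_congr_fun hΩ.measurableSet h1,
    integral_finsetSum _ fun k _ => integrable_finsetSum _ fun j _ => hi1 k j,
    integral_finsetSum _ fun k _ => integrable_finsetSum _ fun j _ => hi2 k j,
    ← Finset.sum_neg_distrib]
  refine Finset.sum_congr rfl fun k _ => ?_
  rw [integral_finsetSum _ fun j _ => hi1 k j, integral_finsetSum _ fun j _ => hi2 k j,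
    ← Finset.sum_neg_distrib]
  exact Finset.sum_congr rfl fun j _ =>
    setIntegral_mul_cderiv hΩ hne hb hu hf hf0 ⟨t, ht⟩ (hBV k j)

end

/-! ### Symmetry of the linearized operator -/

section Hessian

variable {n : ℕ} {Ω : Set (Fin n → ℂ)} {T : Type*} [NormedAddCommGroup T] [NormedSpace ℝ T]

theorem wirtinger_eq_cderiv (j : Fin n) :
    wirtinger j = cderiv (Pi.single j 1) (Pi.single j Complex.I) (-Complex.I) := by
  funext f z
  simp only [wirtinger, cderiv]
  ring

theorem wirtingerBar_eq_cderiv (j : Fin n) :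
    wirtingerBar j = cderiv (Pi.single j 1) (Pi.single j Complex.I) Complex.I := rfl

theorem complexHessian_apply (u : (Fin n → ℂ) → ℝ) (z : Fin n → ℂ) (j k : Fin n) :
    complexHessian u z j k = wirtinger j (wirtingerBar k fun x => (u x : ℂ)) z := rfl

theorem SmoothUpTo.ofReal {J : Set T} {v : T → (Fin n → ℂ) → ℝ} (hv : SmoothUpTo J Ω v) :
    SmoothUpTo J Ω fun t z => (v t z : ℂ) :=
  hv.comp_contDiff Complex.ofRealCLM.contDiff

protected theorem SmoothUpTo.wirtinger {J : Set T} {f : T → (Fin n → ℂ) → ℂ} (hf : SmoothUpTo J Ω f)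
    (hΩ : IsOpen Ω) (hu : UniqueDiffOn ℝ (closure Ω)) (j : Fin n) :
    SmoothUpTo J Ω fun t => wirtinger j (f t) := by
  rw [wirtinger_eq_cderiv]; exact hf.cderiv hΩ hu

protected theorem SmoothUpTo.wirtingerBar {J : Set T} {f : T → (Fin n → ℂ) → ℂ}
    (hf : SmoothUpTo J Ω f)
    (hΩ : IsOpen Ω) (hu : UniqueDiffOn ℝ (closure Ω)) (j : Fin n) :
    SmoothUpTo J Ω fun t => wirtingerBar j (f t) := hf.cderiv hΩ hu

protected theorem SmoothUpTo.complexHessian {J : Set T} {v : T → (Fin n → ℂ) → ℝ}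
    (hv : SmoothUpTo J Ω v)
    (hΩ : IsOpen Ω) (hu : UniqueDiffOn ℝ (closure Ω)) (j k : Fin n) :
    SmoothUpTo J Ω fun t z => complexHessian (v t) z j k :=
  (hv.ofReal.wirtingerBar hΩ hu k).wirtinger hΩ hu j

theorem complexHessian_congr (hΩ : IsOpen Ω) {u v : (Fin n → ℂ) → ℝ} (h : EqOn u v Ω)
    {z : Fin n → ℂ} (hz : z ∈ Ω) : complexHessian u z = complexHessian v z := by
  ext j k
  rw [complexHessian_apply, complexHessian_apply, wirtinger_eq_cderiv]
  exact cderiv_congr hΩ (fun w hw => cderiv_congr hΩ (fun x hx => by simp only [h hx]) hw) hz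

theorem complexHessian_add_const_mul (hΩ : IsOpen Ω) (hu : UniqueDiffOn ℝ (closure Ω))
    {u f : (Fin n → ℂ) → ℝ} (hu' : ContDiffOn ℝ ∞ u (closure Ω))
    (hf : ContDiffOn ℝ ∞ f (closure Ω)) (s : ℝ) {z : Fin n → ℂ} (hz : z ∈ Ω) :
    complexHessian (fun x => u x + s * f x) z =
      complexHessian u z + (s : ℂ) • complexHessian f z := by
  have hU : SmoothUpTo (univ : Set ℝ) Ω fun _ z => (u z : ℂ) :=
    (SmoothUpTo.const_of_contDiffOn hu').ofReal
  have hF : SmoothUpTo (univ : Set ℝ) Ω fun _ z => (f z : ℂ) :=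
    (SmoothUpTo.const_of_contDiffOn hf).ofReal
  have ht := mem_univ (0 : ℝ)
  ext j k
  simp only [Matrix.add_apply, Matrix.smul_apply, smul_eq_mul, complexHessian_apply]
  have h1 : EqOn (wirtingerBar k fun x => ((u x + s * f x : ℝ) : ℂ))
      (fun w => wirtingerBar k (fun x => (u x : ℂ)) w +
        (s : ℂ) * wirtingerBar k (fun x => (f x : ℂ)) w) Ω := by
    intro w hw
    simp only [wirtingerBar_eq_cderiv, Complex.ofReal_add, Complex.ofReal_mul]
    rw [cderiv_add (hU.differentiableAt hΩ ht hw)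
      ((hF.differentiableAt hΩ ht hw).const_mul (s : ℂ)),
      cderiv_const_mul _ (hF.differentiableAt hΩ ht hw)]
  have hd : ∀ {g : (Fin n → ℂ) → ℂ}, (SmoothUpTo (univ : Set ℝ) Ω fun _ => g) →
      DifferentiableAt ℝ (wirtingerBar k g) z := fun hg =>
    (hg.wirtingerBar hΩ hu k).differentiableAt hΩ ht hz
  rw [wirtinger_eq_cderiv, cderiv_congr hΩ h1 hz,
    cderiv_add (hd hU) ((hd hF).const_mul (s : ℂ)), cderiv_const_mul _ (hd hF)]

/-- The linearization `f ↦ tr (adj (Hess w + i) Hess f)` of the determinant is a symmetric operator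
on the functions which vanish on the boundary: Piola's identity in the holomorphic and in the
antiholomorphic directions brings both sides to the form `-∫ ∑ adjₖⱼ ∂ⱼf ∂̄ₖg`. -/
theorem setIntegral_mul_trace_adjugate_comm (hΩ : IsOpen Ω) (hne : Ω ≠ univ)
    (hb : Bornology.IsBounded Ω) (hu : UniqueDiffOn ℝ (closure Ω))
    {w f g : (Fin n → ℂ) → ℝ} (hw : ContDiffOn ℝ ∞ w (closure Ω))
    (hf : ContDiffOn ℝ ∞ f (closure Ω)) (hf0 : ∀ z ∈ frontier Ω, f z = 0)
    (hg : ContDiffOn ℝ ∞ g (closure Ω)) (hg0 : ∀ z ∈ frontier Ω, g z = 0) :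
    ∫ z in Ω, (f z : ℂ) *
        ((complexHessian w z + Complex.I • 1).adjugate * complexHessian g z).trace =
      ∫ z in Ω, (g z : ℂ) *
        ((complexHessian w z + Complex.I • 1).adjugate * complexHessian f z).trace := by
  have hW : SmoothUpTo (univ : Set ℝ) Ω fun _ z => (w z : ℂ) :=
    (SmoothUpTo.const_of_contDiffOn hw).ofReal
  have hF : SmoothUpTo (univ : Set ℝ) Ω fun _ z => (f z : ℂ) :=
    (SmoothUpTo.const_of_contDiffOn hf).ofReal
  have hG : SmoothUpTo (univ : Set ℝ) Ω fun _ z => (g z : ℂ) :=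
    (SmoothUpTo.const_of_contDiffOn hg).ofReal
  have ht := mem_univ (0 : ℝ)
  have hJ : (univ : Set ℝ).Nonempty := ⟨0, ht⟩
  set M : (Fin n → ℂ) → Matrix (Fin n) (Fin n) ℂ := fun z => complexHessian w z + Complex.I • 1
    with hMdef
  have hMa : ∀ z a b, M z a b = complexHessian w z a b + (Complex.I • 1 : Matrix _ _ ℂ) a b :=
    fun z a b => rfl
  have hM : ∀ a b, SmoothUpTo (univ : Set ℝ) Ω fun _ z => M z a b := fun a b =>
    ((SmoothUpTo.const_of_contDiffOn hw).complexHessian hΩ hu a b).add (SmoothUpTo.const _)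
  have hA : ∀ a b, SmoothUpTo (univ : Set ℝ) Ω fun _ z => (M z).adjugate a b :=
    SmoothUpTo.matrix_adjugate hM
  have hdet : ∀ z ∈ Ω, (M z).det ≠ 0 := fun z hz =>
    (complexHessian_isHermitian (((SmoothUpTo.const_of_contDiffOn (J := univ) hw).contDiffAt hΩ ht
      hz).of_le ENat.LEInfty.out)).det_add_I_ne_zero
  have hcomm : ∀ {F : (Fin n → ℂ) → ℂ} (_ : SmoothUpTo (univ : Set ℝ) Ω fun _ => F)
      {X Y X' Y' : Fin n → ℂ} {ε ε' : ℂ} {z : Fin n → ℂ} (_ : z ∈ Ω),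
      cderiv X Y ε (cderiv X' Y' ε' F) z = cderiv X' Y' ε' (cderiv X Y ε F) z := fun hF _ _ _ _ _ _
    _ hz => cderiv_comm ((hF.contDiffAt hΩ ht hz).of_le ENat.LEInfty.out)
  have hMd : ∀ {X Y : Fin n → ℂ} {ε : ℂ} {z : Fin n → ℂ} (_ : z ∈ Ω) (a b : Fin n),
      cderiv X Y ε (fun z => M z a b) z =
        cderiv X Y ε (wirtinger a (wirtingerBar b fun x => (w x : ℂ))) z := by
    intro X Y ε z hz a b
    have h1 := ((hW.wirtingerBar hΩ hu b).wirtinger hΩ hu a).differentiableAt hΩ ht hz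
    simp only [hMa, complexHessian_apply]
    rw [cderiv_add h1 (differentiableAt_const _), cderiv_const, add_zero]
  have hdiv1 : ∀ k, ∀ z ∈ Ω, ∑ j : Fin n, cderiv (Pi.single j 1) (Pi.single j Complex.I)
      (-Complex.I) (fun z => (M z).adjugate k j) z = 0 := by
    intro k z hz
    refine sum_cderiv_adjugate_eq_zero (X := fun j => Pi.single j 1)
      (Y := fun j => Pi.single j Complex.I) (fun a b => (hM a b).differentiableAt hΩ ht hz)
      (fun a b => (hA a b).differentiableAt hΩ ht hz) (hdet z hz) (fun a b j => ?_) k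
    rw [hMd hz, hMd hz, wirtinger_eq_cderiv, wirtinger_eq_cderiv,
      hcomm (hW.wirtingerBar hΩ hu b) hz]
  have hdiv2 : ∀ j, ∀ z ∈ Ω, ∑ k : Fin n, cderiv (Pi.single k 1) (Pi.single k Complex.I)
      Complex.I (fun z => (M z).adjugate k j) z = 0 := by
    intro j z hz
    have key := sum_cderiv_adjugate_eq_zero (X := fun j => Pi.single j 1)
      (Y := fun j => Pi.single j Complex.I) (ε := Complex.I) (M := fun z => (M z)ᵀ) (z := z)
      (fun a b => (hM b a).differentiableAt hΩ ht hz)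
      (fun a b => by
        simp only [← Matrix.adjugate_transpose, Matrix.transpose_apply]
        exact (hA b a).differentiableAt hΩ ht hz)
      (by rw [Matrix.det_transpose]; exact hdet z hz) (fun a b k => ?_) j
    · simpa only [← Matrix.adjugate_transpose, Matrix.transpose_apply] using key
    · simp only [Matrix.transpose_apply]
      rw [hMd hz, hMd hz, wirtinger_eq_cderiv, hcomm (hW.wirtingerBar hΩ hu a) hz,
        hcomm (hW.wirtingerBar hΩ hu k) hz]
      exact cderiv_congr hΩ (fun y hy => hcomm hW hy) hz
  have h1 := setIntegral_mul_sum_cderiv (μ := volume) hΩ hne hb hu hf hf0 hJ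
    (X := fun j => Pi.single j 1) (Y := fun j => Pi.single j Complex.I) (ε := -Complex.I)
    (B := fun k j z => (M z).adjugate k j) (fun k j => hA k j) hdiv1
    (V := fun k => wirtingerBar k fun x => (g x : ℂ)) fun k => hG.wirtingerBar hΩ hu k
  have h2 := setIntegral_mul_sum_cderiv (μ := volume) hΩ hne hb hu hg hg0 hJ
    (X := fun j => Pi.single j 1) (Y := fun j => Pi.single j Complex.I) (ε := Complex.I)
    (B := fun j k z => (M z).adjugate k j) (fun j k => hA k j) hdiv2
    (V := fun j => wirtinger j fun x => (f x : ℂ)) fun j => hF.wirtinger hΩ hu j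
  have e1 : ∀ z ∈ Ω, (f z : ℂ) * ((M z).adjugate * complexHessian g z).trace =
      (f z : ℂ) * ∑ k, ∑ j, (M z).adjugate k j * cderiv (Pi.single j 1) (Pi.single j Complex.I)
        (-Complex.I) (wirtingerBar k fun x => (g x : ℂ)) z := by
    intro z hz
    simp only [Matrix.trace, Matrix.diag_apply, Matrix.mul_apply, complexHessian_apply,
      wirtinger_eq_cderiv]
  have e2 : ∀ z ∈ Ω, (g z : ℂ) * ((M z).adjugate * complexHessian f z).trace =
      (g z : ℂ) * ∑ j, ∑ k, (M z).adjugate k j * cderiv (Pi.single k 1) (Pi.single k Complex.I)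
        Complex.I (wirtinger j fun x => (f x : ℂ)) z := by
    intro z hz
    simp only [Matrix.trace, Matrix.diag_apply, Matrix.mul_apply, complexHessian_apply,
      wirtinger_eq_cderiv]
    rw [Finset.sum_comm]
    refine congrArg _ (Finset.sum_congr rfl fun j _ => Finset.sum_congr rfl fun k _ => ?_)
    rw [wirtingerBar_eq_cderiv, hcomm hF hz]
  rw [setIntegral_congr_fun hΩ.measurableSet e1, setIntegral_congr_fun hΩ.measurableSet e2, h1, h2]
  congr 1
  refine setIntegral_congr_fun hΩ.measurableSet fun z hz => ?_
  rw [Finset.sum_comm]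
  refine Finset.sum_congr rfl fun j _ => Finset.sum_congr rfl fun k _ => ?_
  rw [wirtingerBar_eq_cderiv, wirtinger_eq_cderiv]
  ring

end Hessian

/-! ### The energy along segments -/

section Energy

variable {n : ℕ} {Ω : Set (Fin n → ℂ)} {T : Type*} [NormedAddCommGroup T] [NormedSpace ℝ T]

theorem hessianDensity_congr (hΩ : IsOpen Ω) {u v : (Fin n → ℂ) → ℝ} (h : EqOn u v Ω)
    {z : Fin n → ℂ} (hz : z ∈ Ω) : hessianDensity u z = hessianDensity v z := by
  rw [hessianDensity_eq, hessianDensity_eq, complexHessian_congr hΩ h hz]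

theorem SmoothUpTo.complexHessian_add_I {J : Set T} {v : T → (Fin n → ℂ) → ℝ}
    (hv : SmoothUpTo J Ω v) (hΩ : IsOpen Ω) (hu : UniqueDiffOn ℝ (closure Ω)) (j k : Fin n) :
    SmoothUpTo J Ω fun t z => (complexHessian (v t) z + Complex.I • 1) j k :=
  (hv.complexHessian hΩ hu j k).add (SmoothUpTo.const ((Complex.I • 1 : Matrix _ _ ℂ) j k))

protected theorem SmoothUpTo.hessianDensity {J : Set T} {v : T → (Fin n → ℂ) → ℝ}
    (hv : SmoothUpTo J Ω v)
    (hΩ : IsOpen Ω) (hu : UniqueDiffOn ℝ (closure Ω)) :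
    SmoothUpTo J Ω fun t z => hessianDensity (v t) z := by
  simp only [hessianDensity_eq]
  exact (SmoothUpTo.const _).mul (SmoothUpTo.matrix_det (hv.complexHessian_add_I hΩ hu))

/-- The linearization of `hessianDensity` at `w`, applied to `h`. -/
noncomputable def hessianDensityDeriv (w h : (Fin n → ℂ) → ℝ) (z : Fin n → ℂ) : ℂ :=
  2 ^ n * n.factorial *
    ((complexHessian w z + Complex.I • 1).adjugate * complexHessian h z).trace

protected theorem SmoothUpTo.hessianDensityDeriv {J : Set T} {w h : T → (Fin n → ℂ) → ℝ}
    (hw : SmoothUpTo J Ω w) (hh : SmoothUpTo J Ω h) (hΩ : IsOpen Ω)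
    (hu : UniqueDiffOn ℝ (closure Ω)) :
    SmoothUpTo J Ω fun t z => hessianDensityDeriv (w t) (h t) z := by
  simp only [hessianDensityDeriv, Matrix.trace, Matrix.diag_apply, Matrix.mul_apply]
  exact (SmoothUpTo.const _).mul (SmoothUpTo.sum _ fun k => SmoothUpTo.sum _ fun j =>
    (SmoothUpTo.matrix_adjugate (hw.complexHessian_add_I hΩ hu) k j).mul
      (hh.complexHessian hΩ hu j k))

theorem hasDerivAt_hessianDensity (hΩ : IsOpen Ω) (hu : UniqueDiffOn ℝ (closure Ω))
    {u h : (Fin n → ℂ) → ℝ} (hu' : ContDiffOn ℝ ∞ u (closure Ω))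
    (hh : ContDiffOn ℝ ∞ h (closure Ω)) (s : ℝ) {z : Fin n → ℂ} (hz : z ∈ Ω) :
    HasDerivAt (fun s : ℝ => hessianDensity (fun x => u x + s * h x) z)
      (hessianDensityDeriv (fun x => u x + s * h x) h z) s := by
  simp only [hessianDensity_eq, hessianDensityDeriv,
    complexHessian_add_const_mul hΩ hu hu' hh _ hz]
  refine (HasDerivAt.matrix_det fun i j => ?_).const_mul _
  simp only [Matrix.add_apply, Matrix.smul_apply, smul_eq_mul]
  have h1 : HasDerivAt (fun s : ℝ => (s : ℂ) * complexHessian h z i j)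
      (complexHessian h z i j) s := by
    simpa using (Complex.ofRealCLM.hasDerivAt (x := s)).mul_const (complexHessian h z i j)
  exact (h1.const_add _).add_const _

theorem setIntegral_mul_hessianDensityDeriv_comm (hΩ : IsOpen Ω) (hne : Ω ≠ univ)
    (hb : Bornology.IsBounded Ω) (hu : UniqueDiffOn ℝ (closure Ω))
    {w f g : (Fin n → ℂ) → ℝ} (hw : ContDiffOn ℝ ∞ w (closure Ω))
    (hf : ContDiffOn ℝ ∞ f (closure Ω)) (hf0 : ∀ z ∈ frontier Ω, f z = 0)
    (hg : ContDiffOn ℝ ∞ g (closure Ω)) (hg0 : ∀ z ∈ frontier Ω, g z = 0) :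
    ∫ z in Ω, (f z : ℂ) * hessianDensityDeriv w g z =
      ∫ z in Ω, (g z : ℂ) * hessianDensityDeriv w f z := by
  simp only [hessianDensityDeriv, mul_left_comm _ (2 ^ n * n.factorial : ℂ)]
  rw [integral_const_mul, integral_const_mul,
    setIntegral_mul_trace_adjugate_comm hΩ hne hb hu hw hf hf0 hg hg0]

theorem contDiffOn_add_smul {u h : (Fin n → ℂ) → ℝ} (hu : ContDiffOn ℝ ∞ u (closure Ω))
    (hh : ContDiffOn ℝ ∞ h (closure Ω)) (s : ℝ) :
    ContDiffOn ℝ ∞ (fun x => u x + s * h x) (closure Ω) :=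
  hu.add (contDiffOn_const.mul hh)

/-- The integral of the one-form `h ↦ ∫ h (Hess v + i ω₀)ⁿ` along the segment from `φ` to `ψ`. -/
noncomputable def segmentEnergy (Ω : Set (Fin n → ℂ)) (φ ψ : (Fin n → ℂ) → ℝ) : ℂ :=
  ∫ p in Icc (0 : ℝ) 1 ×ˢ Ω,
    ((ψ p.2 - φ p.2 : ℝ) : ℂ) * hessianDensity (fun x => φ x + p.1 * (ψ x - φ x)) p.2

theorem segmentEnergy_congr (hΩ : IsOpen Ω) {φ ψ ψ' : (Fin n → ℂ) → ℝ} (h : EqOn ψ ψ' Ω) :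
    segmentEnergy Ω φ ψ = segmentEnergy Ω φ ψ' := by
  refine setIntegral_congr_fun (measurableSet_Icc.prod hΩ.measurableSet) fun p hp => ?_
  rw [h hp.2, hessianDensity_congr hΩ (fun x hx => ?_) hp.2]
  simp only [h hx]

theorem segmentEnergy_self (φ : (Fin n → ℂ) → ℝ) : segmentEnergy Ω φ φ = 0 := by
  simp [segmentEnergy]

/-- Integral over `[0, 1]` of the derivative of `s ↦ s (Hess (φ + s k) + i ω₀)ⁿ`. -/
theorem setIntegral_hessianDensity_add_deriv (hΩ : IsOpen Ω) (hb : Bornology.IsBounded Ω)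
    (hu : UniqueDiffOn ℝ (closure Ω)) {φ h k : (Fin n → ℂ) → ℝ}
    (hφ : ContDiffOn ℝ ∞ φ (closure Ω)) (hh : ContDiffOn ℝ ∞ h (closure Ω))
    (hk : ContDiffOn ℝ ∞ k (closure Ω)) :
    ∫ s in Icc (0 : ℝ) 1, ∫ z in Ω, (h z : ℂ) * (hessianDensity (fun x => φ x + s * k x) z +
        s * hessianDensityDeriv (fun x => φ x + s * k x) k z) =
      ∫ z in Ω, (h z : ℂ) * hessianDensity (fun x => φ x + k x) z := by
  have hfam : SmoothUpTo (univ : Set ℝ) Ω fun s x => φ x + s * k x :=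
    (SmoothUpTo.const_of_contDiffOn hφ).add (SmoothUpTo.of_contDiffOn
      (contDiffOn_fst.mul (hk.comp contDiffOn_snd fun p hp => hp.2)))
  have hid : SmoothUpTo (univ : Set ℝ) Ω fun (s : ℝ) _ => (s : ℂ) :=
    SmoothUpTo.of_contDiffOn (Complex.ofRealCLM.contDiff.comp contDiff_fst).contDiffOn
  have hH : SmoothUpTo (univ : Set ℝ) Ω fun _ z => (h z : ℂ) :=
    (SmoothUpTo.const_of_contDiffOn hh).ofReal
  have hD : SmoothUpTo (univ : Set ℝ) Ω fun s z =>
      hessianDensity (fun x => φ x + s * k x) z +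
        s * hessianDensityDeriv (fun x => φ x + s * k x) k z :=
    (hfam.hessianDensity hΩ hu).add
      (hid.mul (hfam.hessianDensityDeriv (SmoothUpTo.const_of_contDiffOn hk) hΩ hu))
  have hint := ((hH.mul hD).reparam (J' := Icc (0 : ℝ) 1) contDiff_id
    (mapsTo_univ _ _)).integrableOn_prod (μ := volume) isCompact_Icc hΩ hb
  rw [IntegrableOn, ← Measure.prod_restrict] at hint
  rw [integral_integral_swap hint]
  refine setIntegral_congr_fun hΩ.measurableSet fun z hz => ?_
  rw [integral_const_mul, integral_Icc_eq_integral_Ioc, ← intervalIntegral.integral_of_le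
    zero_le_one]
  have hder : ∀ s : ℝ, HasDerivAt
      (fun s : ℝ => (s : ℂ) * hessianDensity (fun x => φ x + s * k x) z)
      (hessianDensity (fun x => φ x + s * k x) z +
        s * hessianDensityDeriv (fun x => φ x + s * k x) k z) s := by
    intro s
    simpa using (Complex.ofRealCLM.hasDerivAt (x := s)).fun_mul
      (hasDerivAt_hessianDensity hΩ hu hφ hk s hz)
  have hcont : Continuous fun s : ℝ => hessianDensity (fun x => φ x + s * k x) z +
      s * hessianDensityDeriv (fun x => φ x + s * k x) k z :=
    continuousOn_univ.1 (hD.continuousOn.comp (f := fun s : ℝ => (s, z)) (by fun_prop)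
      fun s _ => ⟨mem_univ s, hz⟩)
  rw [intervalIntegral.integral_eq_sub_of_hasDerivAt (fun s _ => hder s)
    (hcont.intervalIntegrable 0 1)]
  simp

/-- The derivative of the energy of the segment from `φ` to `ψ + τ h`: by the symmetry of the
linearized operator it is the integral of `∂ₛ (s h (Hess (φ + s (ψ + τ h - φ)) + i ω₀)ⁿ)`. -/
theorem hasDerivAt_segmentEnergy (hΩ : IsOpen Ω) (hne : Ω ≠ univ)
    (hb : Bornology.IsBounded Ω) (hu : UniqueDiffOn ℝ (closure Ω)) {φ ψ h : (Fin n → ℂ) → ℝ}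
    (hφ : ContDiffOn ℝ ∞ φ (closure Ω)) (hψ : ContDiffOn ℝ ∞ ψ (closure Ω))
    (hφψ : ∀ z ∈ frontier Ω, ψ z = φ z) (hh : ContDiffOn ℝ ∞ h (closure Ω))
    (hh0 : ∀ z ∈ frontier Ω, h z = 0) (τ : ℝ) :
    HasDerivAt (fun τ : ℝ => segmentEnergy Ω φ fun x => ψ x + τ * h x)
      (∫ z in Ω, (h z : ℂ) * hessianDensity (fun x => ψ x + τ * h x) z) τ := by
  set k : ℝ → (Fin n → ℂ) → ℝ := fun τ x => ψ x + τ * h x - φ x with hkdef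
  set w : ℝ × ℝ → (Fin n → ℂ) → ℝ := fun q x => φ x + q.2 * k q.1 x with hwdef
  have hk : ∀ τ, ContDiffOn ℝ ∞ (k τ) (closure Ω) := fun τ => (contDiffOn_add_smul hψ hh τ).sub hφ
  have hk0 : ∀ τ, ∀ z ∈ frontier Ω, k τ z = 0 := fun τ z hz => by
    simp [hkdef, hφψ z hz, hh0 z hz]
  have hkS : SmoothUpTo (univ : Set (ℝ × ℝ)) Ω fun q => k q.1 := by
    refine ((SmoothUpTo.const_of_contDiffOn hψ).add (SmoothUpTo.of_contDiffOn ?_)).sub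
      (SmoothUpTo.const_of_contDiffOn hφ)
    exact contDiff_fst.fst.contDiffOn.mul (hh.comp contDiffOn_snd fun p hp => hp.2)
  have hsnd : SmoothUpTo (univ : Set (ℝ × ℝ)) Ω fun q _ => (q.2 : ℝ) :=
    SmoothUpTo.of_contDiffOn contDiff_fst.snd.contDiffOn
  have hwS : SmoothUpTo (univ : Set (ℝ × ℝ)) Ω w :=
    (SmoothUpTo.const_of_contDiffOn hφ).add
      ((hsnd.prodMk hkS).comp_contDiff (contDiff_fst.mul contDiff_snd))
  have hhS : SmoothUpTo (univ : Set (ℝ × ℝ)) Ω fun _ => h := SmoothUpTo.const_of_contDiffOn hh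
  set F' : ℝ × ℝ → (Fin n → ℂ) → ℂ := fun q z => (h z : ℂ) * hessianDensity (w q) z +
    (k q.1 z : ℂ) * ((q.2 : ℂ) * hessianDensityDeriv (w q) h z) with hF'def
  have hFS : SmoothUpTo (univ : Set (ℝ × ℝ)) Ω fun q z =>
      (k q.1 z : ℂ) * hessianDensity (w q) z := hkS.ofReal.mul (hwS.hessianDensity hΩ hu)
  have hF'S : SmoothUpTo (univ : Set (ℝ × ℝ)) Ω F' :=
    (hhS.ofReal.mul (hwS.hessianDensity hΩ hu)).add
      (hkS.ofReal.mul (hsnd.ofReal.mul (hwS.hessianDensityDeriv hhS hΩ hu)))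
  have hslice : ∀ {f : ℝ × ℝ → (Fin n → ℂ) → ℂ}, SmoothUpTo (univ : Set (ℝ × ℝ)) Ω f → ∀ τ : ℝ,
      IntegrableOn (fun p : ℝ × (Fin n → ℂ) => f (τ, p.1) p.2) (Icc 0 1 ×ˢ Ω) volume :=
    fun hf τ => (hf.reparam (γ := fun s : ℝ => (τ, s)) (J' := Icc (0 : ℝ) 1)
      (by fun_prop) (mapsTo_univ _ _)).integrableOn_prod isCompact_Icc hΩ hb
  have hms : MeasurableSet (Icc (0 : ℝ) 1 ×ˢ Ω) := measurableSet_Icc.prod hΩ.measurableSet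
  obtain ⟨C, hC0, hC⟩ := (hF'S.reparam (J' := Icc (τ - 1) (τ + 1) ×ˢ Icc (0 : ℝ) 1) contDiff_id
    (mapsTo_univ _ _)).exists_bound (isCompact_Icc.prod isCompact_Icc) hb
  have hder : ∀ (s τ : ℝ), ∀ z ∈ Ω, HasDerivAt
      (fun τ : ℝ => (k τ z : ℂ) * hessianDensity (w (τ, s)) z) (F' (τ, s) z) τ := by
    intro s τ z hz
    have h1 : HasDerivAt (fun τ : ℝ => (k τ z : ℂ)) (h z : ℂ) τ := by
      have : HasDerivAt (fun τ : ℝ => k τ z) (h z) τ := by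
        simpa [hkdef] using (((hasDerivAt_id τ).mul_const (h z)).const_add (ψ z)).sub_const (φ z)
      exact this.ofReal_comp
    have hw' : ∀ τ, w (τ, s) = fun x => (φ x + s * (ψ x - φ x)) + (s * τ : ℝ) * h x := by
      intro τ; funext x; simp only [hwdef, hkdef]; ring
    have h2 : HasDerivAt (fun τ : ℝ => hessianDensity (w (τ, s)) z)
        ((s : ℂ) * hessianDensityDeriv (w (τ, s)) h z) τ := by
      simp only [hw']
      have h3 := hasDerivAt_hessianDensity hΩ hu (contDiffOn_add_smul hφ (hψ.sub hφ) s) hh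
        (s * τ) hz
      have h4 : HasDerivAt (fun τ : ℝ => s * τ) s τ := by
        simpa using (hasDerivAt_id τ).const_mul s
      exact (h3.scomp τ h4).congr_deriv (by simp)
    exact h1.mul h2
  have hmain := hasDerivAt_integral_of_dominated_loc_of_deriv_le
    (μ := volume.restrict (Icc (0 : ℝ) 1 ×ˢ Ω)) (x₀ := τ) (s := Icc (τ - 1) (τ + 1))
    (F := fun τ p => (k τ p.2 : ℂ) * hessianDensity (w (τ, p.1)) p.2)
    (F' := fun τ p => F' (τ, p.1) p.2) (bound := fun _ => C)
    (Icc_mem_nhds (by linarith) (by linarith))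
    (.of_forall fun τ => (hslice hFS τ).aestronglyMeasurable) (hslice hFS τ)
    (hslice hF'S τ).aestronglyMeasurable
    ((ae_restrict_iff' hms).2 (.of_forall fun p hp τ' hτ' => hC (τ', p.1) ⟨hτ', hp.1⟩ p.2 hp.2))
    ?_ ((ae_restrict_iff' hms).2 (.of_forall fun p hp τ' _ => hder p.1 τ' p.2 hp.2))
  · refine hmain.2.congr_deriv ?_
    rw [Measure.volume_eq_prod, setIntegral_prod _ (hslice hF'S τ)]
    have hgoal := setIntegral_hessianDensity_add_deriv hΩ hb hu hφ hh (hk τ)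
    have hfin : (fun x => φ x + k τ x) = fun x => ψ x + τ * h x := by
      funext x; simp only [hkdef]; ring
    rw [hfin] at hgoal
    rw [← hgoal]
    refine setIntegral_congr_fun measurableSet_Icc fun s _ => ?_
    have hcw : ContDiffOn ℝ ∞ (w (τ, s)) (closure Ω) := contDiffOn_add_smul hφ (hk τ) s
    have i1 : IntegrableOn (fun z => (h z : ℂ) * hessianDensity (w (τ, s)) z) Ω :=
      (hhS.ofReal.mul (hwS.hessianDensity hΩ hu)).integrableOn hΩ hb (mem_univ (τ, s))
    have i2 : IntegrableOn (fun z => (k τ z : ℂ) * hessianDensityDeriv (w (τ, s)) h z) Ω :=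
      (hkS.ofReal.mul (hwS.hessianDensityDeriv hhS hΩ hu)).integrableOn hΩ hb (mem_univ (τ, s))
    have i3 : IntegrableOn (fun z => (h z : ℂ) * hessianDensityDeriv (w (τ, s)) (k τ) z) Ω :=
      (hhS.ofReal.mul (hwS.hessianDensityDeriv hkS hΩ hu)).integrableOn hΩ hb (mem_univ (τ, s))
    simp only [hF'def, mul_left_comm _ (s : ℂ), mul_add]
    rw [integral_add i1 (i2.const_mul _), integral_const_mul,
      setIntegral_mul_hessianDensityDeriv_comm hΩ hne hb hu hcw (hk τ) (hk0 τ) hh hh0,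
      integral_add i1 (i3.const_mul _), integral_const_mul]
  · have : IntegrableOn (fun _ : ℝ × (Fin n → ℂ) => (C : ℂ)) (Icc 0 1 ×ˢ Ω) volume :=
      hslice (SmoothUpTo.const (C : ℂ)) 0
    simpa using this.re

/-- The one-form is closed on the triangle with vertices `φ`, `ψ` and `ψ + h`. -/
theorem segmentEnergy_add_sub (hΩ : IsOpen Ω) (hne : Ω ≠ univ)
    (hb : Bornology.IsBounded Ω) (hu : UniqueDiffOn ℝ (closure Ω)) {φ ψ h : (Fin n → ℂ) → ℝ}
    (hφ : ContDiffOn ℝ ∞ φ (closure Ω)) (hψ : ContDiffOn ℝ ∞ ψ (closure Ω))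
    (hφψ : ∀ z ∈ frontier Ω, ψ z = φ z) (hh : ContDiffOn ℝ ∞ h (closure Ω))
    (hh0 : ∀ z ∈ frontier Ω, h z = 0) :
    segmentEnergy Ω φ (fun x => ψ x + h x) - segmentEnergy Ω φ ψ =
      ∫ p in Icc (0 : ℝ) 1 ×ˢ Ω,
        (h p.2 : ℂ) * hessianDensity (fun x => ψ x + p.1 * h x) p.2 := by
  have hfam : SmoothUpTo (Icc (0 : ℝ) 1) Ω fun s x => ψ x + s * h x :=
    (SmoothUpTo.const_of_contDiffOn hψ).add (SmoothUpTo.of_contDiffOn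
      (contDiffOn_fst.mul (hh.comp contDiffOn_snd fun p hp => hp.2)))
  have hint := (((SmoothUpTo.const_of_contDiffOn hh).ofReal).mul
    (hfam.hessianDensity hΩ hu)).integrableOn_prod (μ := volume) isCompact_Icc hΩ hb
  rw [Measure.volume_eq_prod, setIntegral_prod _ hint, integral_Icc_eq_integral_Ioc,
    ← intervalIntegral.integral_of_le zero_le_one,
    intervalIntegral.integral_eq_sub_of_hasDerivAt
      (fun τ _ => hasDerivAt_segmentEnergy hΩ hne hb hu hφ hψ hφψ hh hh0 τ)]
  · simp
  · rw [intervalIntegrable_iff_integrableOn_Icc_of_le zero_le_one]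
    rw [IntegrableOn, ← Measure.prod_restrict] at hint
    exact hint.integral_prod_left

end Energy

/-! ### The energy along smooth families -/

section Families

variable {n : ℕ} {Ω : Set (Fin n → ℂ)} {b : (Fin n → ℂ) → ℝ}

open Filter Topology in
/-- The difference quotients of the energy are integrals over `[0, 1] × Ω`, to which dominated
convergence applies also at the endpoints of the parameter interval. -/
theorem IsSmoothFamily.hasDerivWithinAt_segmentEnergy (hΩ : IsOpen Ω) (hne : Ω ≠ univ)
    (hb : Bornology.IsBounded Ω) (hu : UniqueDiffOn ℝ (closure Ω)) {φ : (Fin n → ℂ) → ℝ}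
    (hφ : φ ∈ potentialSpace Ω b) {a c : ℝ} (hac : a < c) {u : ℝ → (Fin n → ℂ) → ℝ}
    (hfam : IsSmoothFamily Ω b (Icc a c) u) {t : ℝ} (ht : t ∈ Icc a c) :
    HasDerivWithinAt (fun r => segmentEnergy Ω φ (u r))
      (∫ z in Ω, ((derivWithin (fun r => u r z) (Icc a c) t : ℝ) : ℂ) * hessianDensity (u t) z)
      (Icc a c) t := by
  have hU : SmoothUpTo (Icc a c) Ω u := SmoothUpTo.of_contDiffOn hfam.1
  have hUt : SmoothUpTo (Icc a c) Ω fun _ => u t := hU.slice ht _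
  have hu' := uniqueDiffOn_Icc hac
  -- The segment from `u t` to `u r`, as a family with parameters `(r, τ)`.
  set w : ℝ × ℝ → (Fin n → ℂ) → ℝ := fun q x => u t x + q.2 * (u q.1 x - u t x) with hwdef
  have hsnd : SmoothUpTo (Icc a c ×ˢ Icc (0 : ℝ) 1) Ω
      fun (q : ℝ × ℝ) (_ : Fin n → ℂ) => (q.2 : ℝ) :=
    SmoothUpTo.of_contDiffOn contDiff_fst.snd.contDiffOn
  have hwS : SmoothUpTo (Icc a c ×ˢ Icc (0 : ℝ) 1) Ω w :=
    (hU.slice ht _).add ((hsnd.prodMk ((hU.sub hUt).reparam contDiff_fst fun q hq =>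
      hq.1)).comp_contDiff (contDiff_fst.mul contDiff_snd))
  have hDS := hwS.hessianDensity hΩ hu
  obtain ⟨C, hC0, hC⟩ := hDS.exists_bound (isCompact_Icc.prod isCompact_Icc) hb
  obtain ⟨D, hD0, hD⟩ := hU.exists_lipschitz isCompact_Icc hu' (convex_Icc a c) hb
  have hms : MeasurableSet (Icc (0 : ℝ) 1 ×ˢ Ω) := measurableSet_Icc.prod hΩ.measurableSet
  have hdiff : ∀ r ∈ Icc a c, segmentEnergy Ω φ (u r) - segmentEnergy Ω φ (u t) =
      ∫ p in Icc (0 : ℝ) 1 ×ˢ Ω, ((u r p.2 - u t p.2 : ℝ) : ℂ) *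
        hessianDensity (w (r, p.1)) p.2 := by
    intro r hr
    rw [← segmentEnergy_add_sub hΩ hne hb hu hφ.1 (hfam.2 t ht).1
      (fun z hz => by rw [(hfam.2 t ht).2.2 z hz, hφ.2.2 z hz])
      ((hfam.2 r hr).1.sub (hfam.2 t ht).1)
      (fun z hz => by rw [(hfam.2 t ht).2.2 z hz, (hfam.2 r hr).2.2 z hz, sub_self])]
    congr 2
    funext x; ring
  have hlim : (∫ z in Ω, ((derivWithin (fun r => u r z) (Icc a c) t : ℝ) : ℂ) *
      hessianDensity (u t) z) = ∫ p in Icc (0 : ℝ) 1 ×ˢ Ω,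
        ((derivWithin (fun r => u r p.2) (Icc a c) t : ℝ) : ℂ) * hessianDensity (u t) p.2 := by
    have hint : IntegrableOn (fun p : ℝ × (Fin n → ℂ) =>
        ((derivWithin (fun r => u r p.2) (Icc a c) t : ℝ) : ℂ) * hessianDensity (u t) p.2)
        (Icc (0 : ℝ) 1 ×ˢ Ω) (volume.prod volume) :=
      ((((hU.derivWithin hu').ofReal.mul (hU.hessianDensity hΩ hu)).slice ht
        (Icc (0 : ℝ) 1))).integrableOn_prod isCompact_Icc hΩ hb
    rw [Measure.volume_eq_prod, setIntegral_prod _ hint]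
    simp
  rw [hasDerivWithinAt_iff_tendsto_slope, hlim]
  have hslope : ∀ r ∈ Icc a c, slope (fun r => segmentEnergy Ω φ (u r)) t r =
      ∫ p in Icc (0 : ℝ) 1 ×ˢ Ω, ((slope (fun r => u r p.2) t r : ℝ) : ℂ) *
        hessianDensity (w (r, p.1)) p.2 := by
    intro r hr
    rw [slope_def_module, hdiff r hr, ← integral_smul]
    refine setIntegral_congr_fun hms fun p _ => ?_
    simp only [slope_def_module, smul_eq_mul, Complex.real_smul, Complex.ofReal_mul, mul_assoc]
  have hev : ∀ᶠ r in 𝓝[Icc a c \ {t}] t, r ∈ Icc a c \ {t} := self_mem_nhdsWithin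
  refine Tendsto.congr' (f₁ := fun r => ∫ p in Icc (0 : ℝ) 1 ×ˢ Ω,
      ((slope (fun r => u r p.2) t r : ℝ) : ℂ) * hessianDensity (w (r, p.1)) p.2) ?_ ?_
  · filter_upwards [hev] with r hr using (hslope r hr.1).symm
  refine tendsto_integral_filter_of_dominated_convergence (fun _ => D * C) ?_ ?_ ?_ ?_
  · filter_upwards [hev] with r hr
    have h1 : SmoothUpTo (Icc (0 : ℝ) 1) Ω fun s z =>
        ((slope (fun r => u r z) t r : ℝ) : ℂ) * hessianDensity (w (r, s)) z := by
      refine SmoothUpTo.mul (SmoothUpTo.ofReal ?_)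
        (hDS.reparam (γ := fun s : ℝ => (r, s)) (by fun_prop) fun s hs => ⟨hr.1, hs⟩)
      simp only [slope_def_module]
      exact ((hU.slice hr.1 _).sub (hU.slice ht _)).comp_contDiff
        (g := fun y : ℝ => (r - t)⁻¹ • y) (by fun_prop)
    exact (h1.integrableOn_prod (μ := volume) isCompact_Icc hΩ hb).aestronglyMeasurable
  · filter_upwards [hev] with r hr
    refine (ae_restrict_iff' hms).2 (.of_forall fun p hp => ?_)
    rw [norm_mul, Complex.norm_real]
    refine mul_le_mul ?_ (hC (r, p.1) ⟨hr.1, hp.1⟩ p.2 hp.2) (norm_nonneg _) hD0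
    have hrt : 0 < ‖r - t‖ := norm_pos_iff.2 (sub_ne_zero.2 hr.2)
    rw [slope_def_field, norm_div, div_le_iff₀ hrt]
    exact hD t ht r hr.1 p.2 hp.2
  · have : IntegrableOn (fun _ : ℝ × (Fin n → ℂ) => ((D * C : ℝ) : ℂ)) (Icc 0 1 ×ˢ Ω) volume :=
      (SmoothUpTo.const (J := Icc (0 : ℝ) 1) ((D * C : ℝ) : ℂ)).integrableOn_prod
        isCompact_Icc hΩ hb
    simpa using this.re
  · refine (ae_restrict_iff' hms).2 (.of_forall fun p hp => ?_)
    have h1 : Tendsto (fun r => slope (fun r => u r p.2) t r) (𝓝[Icc a c \ {t}] t)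
        (𝓝 (derivWithin (fun r => u r p.2) (Icc a c) t)) :=
      hasDerivWithinAt_iff_tendsto_slope.1 (hU.hasDerivWithinAt ht hp.2)
    have h2 : Tendsto (fun r => hessianDensity (w (r, p.1)) p.2) (𝓝[Icc a c \ {t}] t)
        (𝓝 (hessianDensity (w (t, p.1)) p.2)) := by
      have hc : ContinuousOn (fun r => hessianDensity (w (r, p.1)) p.2) (Icc a c) :=
        hDS.continuousOn.comp (f := fun r : ℝ => ((r, p.1), p.2)) (by fun_prop)
          fun r hr => ⟨⟨hr, hp.1⟩, hp.2⟩
      exact (hc t ht).mono_left (nhdsWithin_mono t sdiff_subset)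
    have hwt : w (t, p.1) = u t := by funext x; simp [hwdef]
    rw [hwt] at h2
    exact ((Complex.continuous_ofReal.tendsto _).comp h1).mul h2

/-- Along a path the derivative of the energy is the first part of the integrand of the functional,
and the second part integrates to `∫ (ψ - φ) (Hess φ + i ω₀)ⁿ`. -/
theorem IsSmoothPath.calabiYauAlong_eq (hΩ : IsOpen Ω) (hne : Ω ≠ univ)
    (hb : Bornology.IsBounded Ω) (hu : UniqueDiffOn ℝ (closure Ω)) {φ ψ : (Fin n → ℂ) → ℝ}
    (hφ : φ ∈ potentialSpace Ω b) {v : ℝ → (Fin n → ℂ) → ℝ} (hv : IsSmoothPath Ω b φ ψ v) :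
    calabiYauAlong Ω φ ψ v =
      segmentEnergy Ω φ ψ + ∫ z in Ω, (φ z : ℂ) * hessianDensity φ z := by
  obtain ⟨hfam, hv0, hv1⟩ := hv
  have hV : SmoothUpTo (Icc 0 1) Ω v := SmoothUpTo.of_contDiffOn hfam.1
  have hV' := hV.derivWithin uniqueDiffOn_Icc_zero_one
  have h0 := left_mem_Icc.2 (zero_le_one' ℝ)
  have h1 := right_mem_Icc.2 (zero_le_one' ℝ)
  have hφS : SmoothUpTo (Icc (0 : ℝ) 1) Ω fun _ => φ := SmoothUpTo.const_of_contDiffOn hφ.1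
  have hS1 := hV'.ofReal.mul (hV.hessianDensity hΩ hu)
  have hS2 := hV'.ofReal.mul (hφS.hessianDensity hΩ hu)
  have hi1 := hS1.integrableOn_prod (μ := volume) isCompact_Icc hΩ hb
  have hi2 := hS2.integrableOn_prod (μ := volume) isCompact_Icc hΩ hb
  rw [IntegrableOn, ← Measure.prod_restrict] at hi1 hi2
  have hI1 : ∫ s in Icc (0 : ℝ) 1, ∫ z in Ω, ((derivWithin (fun r => v r z) (Icc 0 1) s : ℝ) : ℂ) *
      hessianDensity (v s) z = segmentEnergy Ω φ ψ := by
    have hder := fun t (ht : t ∈ Icc (0 : ℝ) 1) =>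
      hfam.hasDerivWithinAt_segmentEnergy hΩ hne hb hu hφ zero_lt_one ht
    rw [integral_Icc_eq_integral_Ioc, ← intervalIntegral.integral_of_le zero_le_one,
      intervalIntegral.integral_eq_sub_of_hasDerivAt_of_le zero_le_one
        (fun t ht => (hder t ht).continuousWithinAt)
        (fun t ht => (hder t (Ioo_subset_Icc_self ht)).hasDerivAt (Icc_mem_nhds ht.1 ht.2)),
      segmentEnergy_congr hΩ (hv0.mono subset_closure),
      segmentEnergy_congr hΩ (hv1.mono subset_closure), segmentEnergy_self, sub_zero]
    rw [intervalIntegrable_iff_integrableOn_Icc_of_le zero_le_one]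
    exact hi1.integral_prod_left
  have hI2 : ∫ s in Icc (0 : ℝ) 1, ∫ z in Ω, ((derivWithin (fun r => v r z) (Icc 0 1) s : ℝ) : ℂ) *
      hessianDensity φ z = ∫ z in Ω, ((ψ z : ℂ) - φ z) * hessianDensity φ z := by
    rw [integral_integral_swap hi2]
    refine setIntegral_congr_fun hΩ.measurableSet fun z hz => ?_
    have hd := fun t (ht : t ∈ Icc (0 : ℝ) 1) => hV.hasDerivWithinAt ht hz
    have hc : ContinuousOn (fun s => derivWithin (fun r => v r z) (Icc 0 1) s) (Icc 0 1) :=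
      hV'.continuousOn.comp (f := fun r : ℝ => (r, z)) (by fun_prop) fun r hr => ⟨hr, hz⟩
    rw [integral_mul_const, integral_complex_ofReal, integral_Icc_eq_integral_Ioc,
      ← intervalIntegral.integral_of_le zero_le_one,
      intervalIntegral.integral_eq_sub_of_hasDerivAt_of_le zero_le_one
        (fun t ht => (hd t ht).continuousWithinAt)
        (fun t ht => (hd t (Ioo_subset_Icc_self ht)).hasDerivAt (Icc_mem_nhds ht.1 ht.2))
        (hc.intervalIntegrable_of_Icc zero_le_one),
      hv0 (subset_closure hz), hv1 (subset_closure hz)]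
    simp
  have hψ : SmoothUpTo (Icc (0 : ℝ) 1) Ω fun _ => ψ :=
    (hV.slice h1 (Icc (0 : ℝ) 1)).congr fun _ _ z hz => (hv1 (subset_closure hz)).symm
  have hj1 := (hψ.ofReal.mul (hφS.hessianDensity hΩ hu)).integrableOn (μ := volume) hΩ hb h0
  have hj2 := (hφS.ofReal.mul (hφS.hessianDensity hΩ hu)).integrableOn (μ := volume) hΩ hb h0
  rw [calabiYauAlong, intervalIntegral.integral_of_le zero_le_one, ← integral_Icc_eq_integral_Ioc]
  have hsplit : ∫ s in Icc (0 : ℝ) 1, ∫ z in Ω,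
      ((derivWithin (fun r => v r z) (Icc 0 1) s : ℝ) : ℂ) *
        (hessianDensity (v s) z - hessianDensity φ z) =
      segmentEnergy Ω φ ψ - ∫ z in Ω, ((ψ z : ℂ) - φ z) * hessianDensity φ z := by
    rw [← hI1, ← hI2, ← integral_sub hi1.integral_prod_left hi2.integral_prod_left]
    refine setIntegral_congr_fun measurableSet_Icc fun s hs => ?_
    simp only [mul_sub]
    exact integral_sub (hS1.integrableOn hΩ hb hs) (hS2.integrableOn hΩ hb hs)
  simp only [hsplit, sub_mul]
  rw [integral_sub hj1 hj2]
  ring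

/-! ### Existence of smooth paths -/

theorem isSmoothPath_segment (hΩ : IsOpen Ω) (hu : UniqueDiffOn ℝ (closure Ω))
    {φ ψ : (Fin n → ℂ) → ℝ} (hφ : φ ∈ potentialSpace Ω b) (hψ : ψ ∈ potentialSpace Ω b) :
    IsSmoothPath Ω b φ ψ fun s x => φ x + s * (ψ x - φ x) := by
  have hherm : ∀ {v : (Fin n → ℂ) → ℝ}, ContDiffOn ℝ ∞ v (closure Ω) → ∀ z ∈ Ω,
      (complexHessian v z).IsHermitian := fun hv z hz =>
    complexHessian_isHermitian (((SmoothUpTo.const_of_contDiffOn (J := (univ : Set ℝ))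
      hv).contDiffAt hΩ (mem_univ 0) hz).of_le ENat.LEInfty.out)
  refine ⟨⟨?_, fun s hs => ⟨contDiffOn_add_smul hφ.1 (hψ.1.sub hφ.1) s, fun z hz => ?_,
    fun z hz => ?_⟩⟩, fun z _ => by simp, fun z _ => by simp⟩
  · have hsnd : ∀ {v : (Fin n → ℂ) → ℝ}, ContDiffOn ℝ ∞ v (closure Ω) →
        ContDiffOn ℝ ∞ (fun p : ℝ × (Fin n → ℂ) => v p.2) (Icc 0 1 ×ˢ closure Ω) := fun hv =>
      hv.comp contDiffOn_snd fun p hp => hp.2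
    exact (hsnd hφ.1).add (contDiffOn_fst.mul ((hsnd hψ.1).sub (hsnd hφ.1)))
  · have h1 : complexHessian (fun x => φ x + s * (ψ x - φ x)) z =
        ((1 - s : ℝ) : ℂ) • complexHessian φ z + (s : ℂ) • complexHessian ψ z := by
      rw [complexHessian_add_const_mul hΩ hu hφ.1 (hψ.1.sub hφ.1) s hz]
      have h2 := complexHessian_add_const_mul hΩ hu hψ.1 hφ.1 (-1) hz
      have h3 : (fun x => ψ x - φ x) = fun x => ψ x + (-1 : ℝ) * φ x := by funext x; ring
      rw [h3, h2]
      ext i j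
      simp
      ring
    rw [h1]
    exact lagrangianPhase_mem_Ioo_of_convex (hherm hφ.1 z hz) (hherm hψ.1 z hz) (hφ.2.1 z hz)
      (hψ.2.1 z hz) (by linarith [hs.2]) hs.1 (by ring)
  · simp [hφ.2.2 z hz, hψ.2.2 z hz]

/-- In dimension zero the phase is zero, and otherwise the whole space is unbounded. -/
theorem ne_univ_of_mem_potentialSpace (hne : Ω.Nonempty) (hb : Bornology.IsBounded Ω)
    {φ : (Fin n → ℂ) → ℝ} (hφ : φ ∈ potentialSpace Ω b) : Ω ≠ univ := by
  rintro rfl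
  obtain ⟨z, hz⟩ := hne
  rcases Nat.eq_zero_or_pos n with rfl | hn
  · have h := (hφ.2.1 z hz).1
    simp [lagrangianPhase] at h
  · have : Nonempty (Fin n) := ⟨⟨0, hn⟩⟩
    exact NormedSpace.unbounded_univ ℝ (Fin n → ℂ) hb

end Families

/-! ### The Calabi–Yau functional -/

theorem mainTheorem2 {n : ℕ} (Ω : Set (Fin n → ℂ)) (hΩ : IsSmoothBoundedDomain Ω)
    (b : (Fin n → ℂ) → ℝ) (φ : (Fin n → ℂ) → ℝ) (hφ : φ ∈ potentialSpace Ω b) :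
    (∀ ψ ∈ potentialSpace Ω b,
      (∃ v, IsSmoothPath Ω b φ ψ v) ∧
      IntegrableOn (fun z => (ψ z : ℂ) * hessianDensity φ z) Ω ∧
      ∀ v, IsSmoothPath Ω b φ ψ v →
        IntegrableOn (fun p : ℝ × (Fin n → ℂ) =>
          ((derivWithin (fun r => v r p.2) (Icc 0 1) p.1 : ℝ) : ℂ) *
            (hessianDensity (v p.1) p.2 - hessianDensity φ p.2)) (Icc 0 1 ×ˢ Ω) ∧
        calabiYauAlong Ω φ ψ v = calabiYau Ω b φ ψ) ∧
    (∀ (a c : ℝ), a < c → ∀ u : ℝ → (Fin n → ℂ) → ℝ, IsSmoothFamily Ω b (Icc a c) u →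
      ∀ t ∈ Icc a c,
        IntegrableOn (fun z =>
          ((derivWithin (fun r => u r z) (Icc a c) t : ℝ) : ℂ) * hessianDensity (u t) z) Ω ∧
        HasDerivWithinAt (fun r => calabiYau Ω b φ (u r))
          (∫ z in Ω, ((derivWithin (fun r => u r z) (Icc a c) t : ℝ) : ℂ) *
            hessianDensity (u t) z)
          (Icc a c) t) := by
  have hu := hΩ.uniqueDiffOn_closure
  have ho := hΩ.isOpen
  have hb := hΩ.isBounded
  have hne := ne_univ_of_mem_potentialSpace hΩ.isConnected.nonempty hb hφ
  have hpath := fun ψ (hψ : ψ ∈ potentialSpace Ω b) =>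
    (⟨_, isSmoothPath_segment ho hu hφ hψ⟩ : ∃ v, IsSmoothPath Ω b φ ψ v)
  have hCY : ∀ ψ ∈ potentialSpace Ω b, calabiYau Ω b φ ψ =
      segmentEnergy Ω φ ψ + ∫ z in Ω, (φ z : ℂ) * hessianDensity φ z := by
    intro ψ hψ
    rw [calabiYau, dif_pos (hpath ψ hψ)]
    exact (hpath ψ hψ).choose_spec.calabiYauAlong_eq ho hne hb hu hφ
  have hφS : SmoothUpTo (Icc (0 : ℝ) 1) Ω fun _ => φ := SmoothUpTo.const_of_contDiffOn hφ.1
  refine ⟨fun ψ hψ => ⟨hpath ψ hψ, ?_, fun v hv => ⟨?_, ?_⟩⟩,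
    fun a c hac u hfam t ht => ⟨?_, ?_⟩⟩
  · exact ((SmoothUpTo.const_of_contDiffOn hψ.1).ofReal.mul
      (hφS.hessianDensity ho hu)).integrableOn ho hb (left_mem_Icc.2 zero_le_one)
  · have hV : SmoothUpTo (Icc (0 : ℝ) 1) Ω v := SmoothUpTo.of_contDiffOn hv.1.1
    exact ((hV.derivWithin uniqueDiffOn_Icc_zero_one).ofReal.mul
      ((hV.hessianDensity ho hu).sub (hφS.hessianDensity ho hu))).integrableOn_prod
      isCompact_Icc ho hb
  · rw [hCY ψ hψ, hv.calabiYauAlong_eq ho hne hb hu hφ]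
  · have hU : SmoothUpTo (Icc a c) Ω u := SmoothUpTo.of_contDiffOn hfam.1
    exact ((hU.derivWithin (uniqueDiffOn_Icc hac)).ofReal.mul
      (hU.hessianDensity ho hu)).integrableOn ho hb ht
  · have h := (hfam.hasDerivWithinAt_segmentEnergy ho hne hb hu hφ hac ht).add_const
      (∫ z in Ω, (φ z : ℂ) * hessianDensity φ z)
    exact h.congr (fun r hr => hCY _ (hfam.2 r hr)) (hCY _ (hfam.2 t ht))
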